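/- Let $d\ge 1$, let $\mathbb T^d=(\mathbb R/\mathbb Z)^d$ with Lebesgue measure $du$, and let $\chi(a)=a(1-a)$. Let $\mathcal M_d$ be the space of $\mathbb R^d$-valued finite signed measures on $\mathbb T^d$ with the weak topology (tested against continuous vector fields), $\mathcal F$ the set of measurable $\rho:\mathbb T^d\to[0,1]$ with the weak topology (tested against continuous functions), and $\mathcal F_m=\{\rho\in\mathcal F:\int\rho\,du=m\}$. Write $\langle\cdot,\cdot\rangle$ for the pairings, and let $\mathcal B=\{J\in\mathcal M_d:\langle J,\nabla f\rangle=0\ \text{for all } f\in C^1(\mathbb T^d)\}$. For $m\in(0,1)$ define $U_m:\mathcal M_d\to[0,+\infty]$ by $$U_m(J)=\inf_{\substack{\rho\in\mathcal F_m\cap C^2(\mathbb T^d)\\ 0<\rho<1}}\ \frac12\int_{\mathbb T^d}\frac{|j+\frac12\nabla\rho|^2}{\rho(1-\rho)}\,du$$ if $J\in\mathcal B$ and $J(du)=j\,du$, and $U_m(J)=+\infty$ otherwise. For $T>0$ and $\gamma\in C^2(\mathbb T^d)\cap\mathcal F$, let $\mathfrak A_\gamma$ be the set of càdlàg paths $(W,\pi):[0,T]\to\mathcal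 M_d\times\mathcal F$ with $W_0=0$ and $\langle\pi_t,F\rangle-\langle\gamma,F\rangle=\langle W_t,\nabla F\rangle$ for all $t\in[0,T]$ and $F\in C^1(\mathbb T^d)$. For $(W,\pi)\in\mathfrak A_\gamma$ continuous on $[0,T]$ let $$I_{[0,T]}((W,\pi)|\gamma)=\sup_{F}\Big\{\langle W_T,F_T\rangle-\int_0^T\langle W_t,\partial_tF_t\rangle dt-\frac12\int_0^T\langle\pi_t,\nabla\cdot F_t\rangle dt-\frac12\int_0^T\langle\chi(\pi_t),|F_t|^2\rangle dt\Big\},$$ the supremum being over all $F\in C^{1,1}([0,T]\times\mathbb T^d;\mathbb R^d)$, and let $I_{[0,T]}((W,\pi)|\gamma)=+\infty$ for every other pair of paths. Since $W$ and $\gamma$ determine $\pi$ (up to null sets) through $(W,\pi)\in\mathfrak A_\gamma$, write $I_{[0,T]}(W|\gamma)$ for this quantity, equal to $+\infty$ if there is no such $\pi$. Let $$\Phi_T(J|\gamma)=\frac1T\inf\{I_{[0,T]}(W|\gamma): W\in D([0,T];\mathcal M_d),\ W_T=TJ\},$$ let $\tilde\Phi(J|\gamma)=\inf_{T>0}\Phi_T(J|\gamma)$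 if $J\in\mathcal B$ and $\tilde\Phi(J|\gamma)=+\infty$ otherwise, and let $\Phi(J|\gamma)=\sup_{V\ni J,\ V\text{ open}}\ \inf_{J'\in V}\tilde\Phi(J'|\gamma)$ be the lower semicontinuous envelope of $\tilde\Phi(\cdot|\gamma)$. **Proposition.** For each $m\in(0,1)$ the functional $U_m:\mathcal M_d\to[0,+\infty]$ is lower semicontinuous. Moreover, if $\gamma\in C^2(\mathbb T^d)\cap\mathcal F_m$ is bounded away from $0$ and $1$ (that is, $\delta\le\gamma\le1-\delta$ for some $\delta>0$), then $U_m(J)=\Phi(J|\gamma)$ for every $J\in\mathcal M_d$. -/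

import Mathlib

open MeasureTheory Filter Topology
open scoped ENNReal

/-- The `d`-dimensional torus `𝕋^d = (ℝ / ℤ)^d` of side one.  It carries the Borel σ-algebra and
the Lebesgue (Haar) probability measure `volume`. -/
abbrev Torus (d : ℕ) : Type := UnitAddTorus (Fin d)

namespace Torus

/-- The quotient map `ℝ^d → 𝕋^d`. -/
def proj {d : ℕ} (x : Fin d → ℝ) : Torus d := fun i => (x i : UnitAddCircle)

/-- `f : 𝕋^d → ℝ` is of class `C^n`: its periodic lift to `ℝ^d` is of class `C^n`. -/
def IsC {d : ℕ} (n : ℕ) (f : Torus d → ℝ) : Prop :=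
  ContDiff ℝ n (fun x : Fin d → ℝ => f (proj x))

/-- The partial derivative `∂_i f` of a function on the torus. -/
noncomputable def pderiv {d : ℕ} (i : Fin d) (f : Torus d → ℝ) (u : Torus d) : ℝ :=
  deriv (fun s : ℝ => f (u + Pi.single i (s : UnitAddCircle))) 0

/-- The divergence `∇ · F = ∑ᵢ ∂_i F_i` of a vector field on the torus. -/
noncomputable def div {d : ℕ} (F : Torus d → Fin d → ℝ) (u : Torus d) : ℝ :=
  ∑ i, pderiv i (fun v => F v i) u

end Torus

namespace MeanCurrent

/-! ### Measures and profiles -/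

/-- The pairing `⟨μ, F⟩ = ∫ F dμ` of a finite signed measure with a function. -/
noncomputable def pair {d : ℕ} (μ : SignedMeasure (Torus d)) (F : Torus d → ℝ) : ℝ :=
  ∫ᵛ u, F u ∂•μ

/-- The weak topology on the finite signed measures on the torus: the coarsest one for which
`μ ↦ ⟨μ, F⟩` is continuous for each continuous `F`. -/
noncomputable instance weakTopology (d : ℕ) : TopologicalSpace (SignedMeasure (Torus d)) :=
  TopologicalSpace.induced (fun μ (F : C(Torus d, ℝ)) => pair μ F) inferInstance

/-- `𝓜_d = 𝓜(𝕋^d)^d`, the vector-valued finite signed measures on `𝕋^d`, with the product of the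
weak topologies. -/
abbrev Current (d : ℕ) : Type := Fin d → SignedMeasure (Torus d)

/-- `⟨J, F⟩ = ∑ᵢ ⟨J_i, F_i⟩` for a vector-valued measure `J` and a vector field `F`. -/
noncomputable def vpair {d : ℕ} (J : Current d) (F : Torus d → Fin d → ℝ) : ℝ :=
  ∑ i, pair (J i) (fun u => F u i)

/-- `𝓕`, the measurable density profiles on the torus with values in `[0, 1]`. -/
def Profile (d : ℕ) : Type :=
  {ρ : Torus d → ℝ // Measurable ρ ∧ ∀ u, 0 ≤ ρ u ∧ ρ u ≤ 1}

instance (d : ℕ) : CoeFun (Profile d) (fun _ => Torus d → ℝ) := ⟨Subtype.val⟩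

/-- `⟨ρ, F⟩ = ∫ ρ F du`. -/
noncomputable def dpair {d : ℕ} (ρ F : Torus d → ℝ) : ℝ := ∫ u, ρ u * F u

/-- The weak topology on `𝓕`.  (Two profiles that are equal almost everywhere are
topologically indistinguishable.) -/
noncomputable instance profileTopology (d : ℕ) : TopologicalSpace (Profile d) :=
  TopologicalSpace.induced (fun ρ (F : C(Torus d, ℝ)) => dpair ρ F) inferInstance

/-- `𝓕_m`, the profiles of total mass `m`. -/
def massProfiles (d : ℕ) (m : ℝ) : Set (Profile d) := {ρ | ∫ u, ρ u = m}

/-- The mobility `χ(a) = a (1 - a)`. -/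
def chi (a : ℝ) : ℝ := a * (1 - a)

/-- `𝓑`, the divergence free vector-valued measures. -/
def divFree (d : ℕ) : Set (Current d) :=
  {J | ∀ f : Torus d → ℝ, Torus.IsC 1 f → vpair J (fun u i => Torus.pderiv i f u) = 0}

/-- `J(du) = j du` for the integrable vector field `j` (which is then unique up to null sets). -/
def HasDensity {d : ℕ} (J : Current d) (j : Torus d → Fin d → ℝ) : Prop :=
  ∀ i, Integrable (fun u => j u i) ∧ J i = volume.withDensityᵥ (fun u => j u i)

/-! ### The time independent variational problem -/

/-- `½ ⟨ [j + ½ ∇ρ], (ρ (1 - ρ))⁻¹ [j + ½ ∇ρ] ⟩ ∈ [0, ∞]`, for `0 < ρ < 1`. -/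
noncomputable def staticCost {d : ℕ} (ρ : Torus d → ℝ) (j : Torus d → Fin d → ℝ) : ℝ≥0∞ :=
  2⁻¹ * ∫⁻ u, ENNReal.ofReal
    ((∑ i, (j u i + (1 / 2) * Torus.pderiv i ρ u) ^ 2) / chi (ρ u))

/-- `U_m(J)`: the infimum of `staticCost ρ j` over the `C²` profiles `0 < ρ < 1` of mass `m` if `J`
is divergence free with `J(du) = j du`.  If `J` is not divergence free or has no density, then
this is the infimum of the empty set, `+∞`.  (As `j` is unique up to null sets and `staticCost`
does not see null sets, there is no minimization over `j`.) -/
noncomputable def U {d : ℕ} (m : ℝ) (J : Current d) : ℝ≥0∞ :=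
  ⨅ (j : Torus d → Fin d → ℝ) (_ : J ∈ divFree d ∧ HasDensity J j)
    (ρ : Profile d) (_ : ρ ∈ massProfiles d m ∧ Torus.IsC 2 ρ ∧ ∀ u, 0 < ρ u ∧ ρ u < 1),
    staticCost ρ j

/-! ### The dynamical rate function

Paths on `[0, T]` are written as functions of `t : ℝ`, of which only the values on `[0, T]`
are used. -/

/-- `x` is càdlàg on `[0, T]`: right continuous with left limits. -/
def IsCadlagOn {X : Type*} [TopologicalSpace X] (T : ℝ) (x : ℝ → X) : Prop :=
  (∀ t ∈ Set.Ico 0 T, ContinuousWithinAt x (Set.Icc t T) t) ∧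
    ∀ t ∈ Set.Ioc 0 T, ∃ l, Tendsto x (𝓝[Set.Ico 0 t] t) (𝓝 l)

/-- `𝔄_γ`, the càdlàg paths `(W, π)` on `[0, T]` that solve the weak form of the continuity
equation `∂_t π + ∇ · ∂_t W = 0` with `π_0 = γ`, `W_0 = 0`. -/
def continuityPaths {d : ℕ} (T : ℝ) (γ : Torus d → ℝ) :
    Set ((ℝ → Current d) × (ℝ → Profile d)) :=
  {p | IsCadlagOn T p.1 ∧ IsCadlagOn T p.2 ∧ p.1 0 = 0 ∧
    ∀ t ∈ Set.Icc 0 T, ∀ F : Torus d → ℝ, Torus.IsC 1 F →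
      dpair (p.2 t) F - dpair γ F = vpair (p.1 t) (fun u i => Torus.pderiv i F u)}

/-- The time dependent vector field `F` is of class `C^{1,1}` in time and space.  (A field of class
`C^{1,1}` on `[0, T] × 𝕋^d` is the restriction of such a field on `ℝ × 𝕋^d`.) -/
def IsC11 {d : ℕ} (F : ℝ → Torus d → Fin d → ℝ) : Prop :=
  ContDiff ℝ 1 (fun p : ℝ × (Fin d → ℝ) => F p.1 (Torus.proj p.2))

/-- `⟨W_T, F_T⟩ - ∫_0^T ⟨W_t, ∂_t F_t⟩ dt - ½ ∫_0^T ⟨π_t, ∇ · F_t⟩ dt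
- ½ ∫_0^T ⟨χ(π_t), |F_t|²⟩ dt`. -/
noncomputable def dynFunctional {d : ℕ} (T : ℝ) (W : ℝ → Current d) (π : ℝ → Profile d)
    (F : ℝ → Torus d → Fin d → ℝ) : ℝ :=
  vpair (W T) (F T)
    - (∫ t in (0 : ℝ)..T, vpair (W t) (fun u i => deriv (fun s => F s u i) t))
    - (1 / 2) * (∫ t in (0 : ℝ)..T, dpair (π t) (Torus.div (F t)))
    - (1 / 2) * ∫ t in (0 : ℝ)..T, dpair (fun u => chi (π t u)) (fun u => ∑ i, F t u i ^ 2)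

open Classical in
/-- The supremum over all `F` of class `C^{1,1}` of `dynFunctional T W π F` if `(W, π)` is continuous
on `[0, T]`, and `+∞` otherwise.  (Since `F = 0` gives the value zero, replacing negative values
by zero does not change the supremum.) -/
noncomputable def dynCost {d : ℕ} (T : ℝ) (W : ℝ → Current d) (π : ℝ → Profile d) : ℝ≥0∞ :=
  if ContinuousOn W (Set.Icc 0 T) ∧ ContinuousOn π (Set.Icc 0 T) then
    ⨆ (F : ℝ → Torus d → Fin d → ℝ) (_ : IsC11 F), ENNReal.ofReal (dynFunctional T W π F)
  else ⊤

open Classical in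
/-- The rate function `I_{[0,T]}((W, π) | γ)`. -/
noncomputable def rate {d : ℕ} (T : ℝ) (γ : Torus d → ℝ)
    (W : ℝ → Current d) (π : ℝ → Profile d) : ℝ≥0∞ :=
  if (W, π) ∈ continuityPaths T γ then dynCost T W π else ⊤

/-- `I_{[0,T]}(W | γ)`: the rate function at `(W, π)`, with `π` the solution of the continuity
equation driven by `W`; it is `+∞` if there is no such `π`.  (For each `t`, the profile `π_t` is
determined by `W` up to a null set, on which the rate function does not depend, so there is no
minimization over `π`.) -/
noncomputable def currentRate {d : ℕ} (T : ℝ) (γ : Torus d → ℝ) (W : ℝ → Current d) : ℝ≥0∞ :=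
  ⨅ π : ℝ → Profile d, rate T γ W π

/-- `𝓐_{T,J}`, the càdlàg paths `W` on `[0, T]` with `W_T = T J`. -/
def meanPaths {d : ℕ} (T : ℝ) (J : Current d) : Set (ℝ → Current d) :=
  {W | IsCadlagOn T W ∧ W T = T • J}

/-- `Φ_T(J | γ) = T⁻¹ inf {I_{[0,T]}(W | γ) : W ∈ 𝓐_{T,J}}`. -/
noncomputable def PhiT {d : ℕ} (T : ℝ) (γ : Torus d → ℝ) (J : Current d) : ℝ≥0∞ :=
  (ENNReal.ofReal T)⁻¹ * ⨅ W ∈ meanPaths T J, currentRate T γ W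

open Classical in
/-- `inf_{T > 0} Φ_T(J | γ)` for divergence free `J`, and `+∞` otherwise. -/
noncomputable def PhiTilde {d : ℕ} (γ : Torus d → ℝ) (J : Current d) : ℝ≥0∞ :=
  if J ∈ divFree d then ⨅ (T : ℝ) (_ : 0 < T), PhiT T γ J else ⊤

/-- `Φ(· | γ)`, the lower semicontinuous envelope of `PhiTilde γ`. -/
noncomputable def Phi {d : ℕ} (γ : Torus d → ℝ) (J : Current d) : ℝ≥0∞ :=
  ⨆ (V : Set (Current d)) (_ : IsOpen V ∧ J ∈ V), ⨅ J' ∈ V, PhiTilde γ J'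

end MeanCurrent

/-! The proof rests on a dual description of the static cost. Legendre duality gives `½|a|²/χ =
sup_F (a·F - ½χ|F|²)`. As `χ` is concave, `χ(ρ)` is the minimum over `g` of its tangent lines `(1 -
2g)ρ + g²`. Taking `a = j + ½∇ρ` and integrating by parts, the cost of `(J, ρ)` becomes a supremum
of the functionals `affineAction`. These are affine and weakly continuous in `(J, ρ)` and make sense
for a merely measurable profile. The condition `ActionLE c J ρ` says that all of them are at most
`c`.

The central lemma is `ActionLE.U_le`: for divergence free `J` and any measurable profile of mass
`m`, `ActionLE c J ρ` implies `U m J ≤ c`. The bound forces `J` to have an `L²` density. Mollifying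
the pair preserves the bound, since the functionals are affine and translation covariant. Mixing the
result with the pair `(0, m)` also preserves it, and keeps the profile away from `0` and `1`. For
the resulting smooth pair the supremum is attained. Returning from the smoothed current to `J` costs
an `L²` error much smaller than the mobility.

Lower semicontinuity: a sublevel set of `U` is an intersection of projections of closed sets along
the space of profiles, which is compact (`U_le_iff`, `lowerSemicontinuous_U`).

`U ≤ Phi`: test the rate function with fields constant in time. The functionals are affine, so the
path of profiles may be replaced by its time average, and `ActionLE` holds for `J` and this average.
Hence `U ≤ PhiTilde`, and semicontinuity gives `U ≤ Phi`.

`Phi ≤ U`: given an admissible `ρ`, move from `γ` to `ρ` in unit time with the current `invDiv`,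
stay at `ρ` with current `J` for time `T - 2`, then move back with the opposite current. The mean
current is `(1 - 2/T) J` and the mean cost tends to the static cost as `T → ∞`. The envelope absorbs
the factor `1 - 2/T` (`Phi_le_staticCost`). -/

namespace Torus

variable {d : ℕ}

/-! ### Calculus on the torus through periodic lifts. -/

instance isProbabilityMeasure_unitAddCircle :
    IsProbabilityMeasure (volume : Measure UnitAddCircle) :=
  ⟨by simp⟩

instance isProbabilityMeasure_volume : IsProbabilityMeasure (volume : Measure (Torus d)) := by
  unfold Torus UnitAddTorus
  infer_instance

theorem isOpenQuotientMap_proj : IsOpenQuotientMap (proj : (Fin d → ℝ) → Torus d) :=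
  IsOpenQuotientMap.piMap (f := fun (_ : Fin d) (x : ℝ) => (x : UnitAddCircle))
    fun _ => QuotientAddGroup.isOpenQuotientMap_mk

theorem proj_surjective : Function.Surjective (proj : (Fin d → ℝ) → Torus d) :=
  isOpenQuotientMap_proj.surjective

theorem continuous_proj : Continuous (proj : (Fin d → ℝ) → Torus d) :=
  isOpenQuotientMap_proj.continuous

@[simp] theorem proj_add (x y : Fin d → ℝ) : proj (x + y) = proj x + proj y := by
  ext i; simp [proj]

@[simp] theorem proj_zero : proj (0 : Fin d → ℝ) = 0 := by
  ext i; simp [proj]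

theorem proj_single (i : Fin d) (s : ℝ) :
    proj (Pi.single i s) = Pi.single i (s : UnitAddCircle) := by
  ext j
  by_cases h : j = i
  · subst h; simp [proj]
  · simp [proj, h]

theorem continuous_lift_iff {Y : Type*} [TopologicalSpace Y] {f : Torus d → Y} :
    Continuous f ↔ Continuous (fun x => f (proj x)) :=
  isOpenQuotientMap_proj.isQuotientMap.continuous_iff

theorem continuous_prod_lift_iff {X Y : Type*} [TopologicalSpace X] [TopologicalSpace Y]
    {f : X × Torus d → Y} :
    Continuous f ↔ Continuous (fun p : X × (Fin d → ℝ) => f (p.1, proj p.2)) :=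
  (IsOpenQuotientMap.id.prodMap isOpenQuotientMap_proj).isQuotientMap.continuous_iff

/-! ### Functions of class `C^n` -/

theorem IsC.continuous {n : ℕ} {f : Torus d → ℝ} (hf : IsC n f) : Continuous f :=
  continuous_lift_iff.2 (ContDiff.continuous hf)

theorem IsC.of_le {m n : ℕ} {f : Torus d → ℝ} (hf : IsC n f) (h : m ≤ n) : IsC m f :=
  ContDiff.of_le hf (by exact_mod_cast h)

theorem isC_const (n : ℕ) (c : ℝ) : IsC n (fun _ : Torus d => c) := contDiff_const

theorem IsC.add {n : ℕ} {f g : Torus d → ℝ} (hf : IsC n f) (hg : IsC n g) :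
    IsC n (fun u => f u + g u) := ContDiff.add hf hg

theorem IsC.mul {n : ℕ} {f g : Torus d → ℝ} (hf : IsC n f) (hg : IsC n g) :
    IsC n (fun u => f u * g u) := ContDiff.mul hf hg

theorem IsC.sub {n : ℕ} {f g : Torus d → ℝ} (hf : IsC n f) (hg : IsC n g) :
    IsC n (fun u => f u - g u) := ContDiff.sub hf hg

theorem IsC.const_mul {n : ℕ} {f : Torus d → ℝ} (c : ℝ) (hf : IsC n f) :
    IsC n (fun u => c * f u) := (isC_const n c).mul hf

theorem IsC.div {n : ℕ} {f g : Torus d → ℝ} (hf : IsC n f) (hg : IsC n g) (h0 : ∀ u, g u ≠ 0) :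
    IsC n (fun u => f u / g u) := ContDiff.div hf hg fun x => h0 (proj x)

theorem isC_sum {ι : Type*} {n : ℕ} {f : ι → Torus d → ℝ} (s : Finset ι)
    (hf : ∀ i ∈ s, IsC n (f i)) : IsC n (fun u => ∑ i ∈ s, f i u) :=
  ContDiff.sum (f := fun i x => f i (proj x)) hf

theorem IsC.comp_add {n : ℕ} {f : Torus d → ℝ} (hf : IsC n f) (y : Torus d) :
    IsC n (fun u => f (u + y)) := by
  obtain ⟨z, rfl⟩ := proj_surjective y
  have : ContDiff ℝ n (fun x : Fin d → ℝ => f (proj (x + z))) :=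
    ContDiff.comp (g := fun x => f (proj x)) hf (contDiff_id.add contDiff_const)
  simpa [IsC] using this

/-! ### Derivatives -/

theorem IsC.hasFDerivAt {f : Torus d → ℝ} (hf : IsC 1 f) (x : Fin d → ℝ) :
    HasFDerivAt (fun x => f (proj x)) (fderiv ℝ (fun x => f (proj x)) x) x :=
  ((ContDiff.differentiable hf one_ne_zero) x).hasFDerivAt

/-- The definition of `pderiv` differentiates along a curve in the torus. Passing to the Fréchet
derivative of the lift makes the chain rule and the smoothness of derivatives available. -/
theorem IsC.pderiv_proj {f : Torus d → ℝ} (hf : IsC 1 f) (i : Fin d) (x : Fin d → ℝ) :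
    pderiv i f (proj x) = fderiv ℝ (fun x => f (proj x)) x (Pi.single i 1) := by
  have h1 : HasFDerivAt (fun x => f (proj x)) (fderiv ℝ (fun x => f (proj x)) x)
      (x + (0 : ℝ) • Pi.single i (1 : ℝ)) := by
    simpa using hf.hasFDerivAt x
  have h2 : HasDerivAt (fun s : ℝ => x + s • Pi.single i (1 : ℝ)) (Pi.single i 1) 0 := by
    simpa using ((hasDerivAt_id (0 : ℝ)).smul_const (Pi.single i (1 : ℝ))).const_add x
  rw [← (h1.comp_hasDerivAt (0 : ℝ) h2).deriv]
  simp only [pderiv, Function.comp_def, proj_add, ← Pi.single_smul', smul_eq_mul, mul_one,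
    proj_single]

theorem IsC.hasDerivAt_line {f : Torus d → ℝ} (hf : IsC 1 f) (u : Torus d) (r : Fin d → ℝ)
    (s : ℝ) : HasDerivAt (fun s : ℝ => f (u + proj (s • r)))
      (∑ i, r i * pderiv i f (u + proj (s • r))) s := by
  obtain ⟨x, rfl⟩ := proj_surjective u
  have h2 : HasDerivAt (fun s : ℝ => x + s • r) r s := by
    simpa using ((hasDerivAt_id s).smul_const r).const_add x
  have h3 := (hf.hasFDerivAt (x + s • r)).comp_hasDerivAt s h2
  have h5 : fderiv ℝ (fun x => f (proj x)) (x + s • r) r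
      = ∑ i, r i * pderiv i f (proj x + proj (s • r)) := by
    conv_lhs => arg 2; rw [pi_eq_sum_univ' r]
    rw [map_sum]
    refine Finset.sum_congr rfl fun i _ => ?_
    rw [map_smul, ← proj_add, hf.pderiv_proj, smul_eq_mul]
  rw [h5] at h3
  simpa [Function.comp_def] using h3

theorem IsC.hasDerivAt_single {f : Torus d → ℝ} (hf : IsC 1 f) (i : Fin d) (u : Torus d)
    (s : ℝ) : HasDerivAt (fun s : ℝ => f (u + Pi.single i (s : UnitAddCircle)))
      (pderiv i f (u + Pi.single i (s : UnitAddCircle))) s := by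
  have := hf.hasDerivAt_line u (Pi.single i 1) s
  simpa [← Pi.single_smul', proj_single, Pi.single_apply] using this

theorem IsC.hasDerivAt_zero {f : Torus d → ℝ} (hf : IsC 1 f) (i : Fin d) (u : Torus d) :
    HasDerivAt (fun s : ℝ => f (u + Pi.single i (s : UnitAddCircle))) (pderiv i f u) 0 := by
  simpa using hf.hasDerivAt_single i u 0

theorem IsC.pderiv {n : ℕ} {f : Torus d → ℝ} (hf : IsC (n + 1) f) (i : Fin d) :
    IsC n (pderiv i f) := by
  have h1 : IsC 1 f := hf.of_le (by omega)
  unfold IsC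
  simp_rw [h1.pderiv_proj i]
  exact (ContDiff.fderiv_right (m := n) hf (by push_cast; rfl)).clm_apply contDiff_const

theorem pderiv_comp_add (f : Torus d → ℝ) (i : Fin d) (y u : Torus d) :
    pderiv i (fun v => f (v + y)) u = pderiv i f (u + y) := by
  simp only [Torus.pderiv, add_right_comm]

@[simp] theorem pderiv_const (i : Fin d) (c : ℝ) (u : Torus d) :
    pderiv i (fun _ => c) u = 0 := by
  simp [Torus.pderiv]

theorem pderiv_add {f g : Torus d → ℝ} (hf : IsC 1 f) (hg : IsC 1 g) (i : Fin d) (u : Torus d) :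
    pderiv i (fun v => f v + g v) u = pderiv i f u + pderiv i g u :=
  ((hf.hasDerivAt_zero i u).add (hg.hasDerivAt_zero i u)).deriv

theorem pderiv_mul {f g : Torus d → ℝ} (hf : IsC 1 f) (hg : IsC 1 g) (i : Fin d) (u : Torus d) :
    pderiv i (fun v => f v * g v) u = pderiv i f u * g u + f u * pderiv i g u := by
  have := ((hf.hasDerivAt_zero i u).fun_mul (hg.hasDerivAt_zero i u)).deriv
  simpa [Torus.pderiv] using this

theorem pderiv_const_mul {f : Torus d → ℝ} (c : ℝ) (hf : IsC 1 f) (i : Fin d) (u : Torus d) :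
    pderiv i (fun v => c * f v) u = c * pderiv i f u :=
  ((hf.hasDerivAt_zero i u).const_mul c).deriv

/-! ### Translations -/

/-- The translate `u ↦ F (u + y)`. -/
def translate (y : Torus d) (F : C(Torus d, ℝ)) : C(Torus d, ℝ) :=
  F.comp ⟨fun u => u + y, by fun_prop⟩

@[simp] theorem translate_apply (y : Torus d) (F : C(Torus d, ℝ)) (u : Torus d) :
    translate y F u = F (u + y) := rfl

@[simp] theorem translate_zero (F : C(Torus d, ℝ)) : translate 0 F = F := by
  ext u; simp

theorem continuous_translate (F : C(Torus d, ℝ)) : Continuous fun y => translate y F :=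
  ContinuousMap.continuous_of_continuous_uncurry _
    (show Continuous fun p : Torus d × Torus d => F (p.2 + p.1) by fun_prop)

/-- A curve in `C(X, ℝ)` that is pointwise differentiable, with a continuous derivative, is
differentiable in the uniform norm. -/
theorem hasDerivAt_curve {X : Type*} [TopologicalSpace X] [CompactSpace X] {G G' : ℝ → C(X, ℝ)}
    (hG' : Continuous G') (h : ∀ t x, HasDerivAt (fun s => G s x) (G' t x) t) (t : ℝ) :
    HasDerivAt G (G' t) t := by
  have hint : ∀ a b, IntervalIntegrable G' volume a b := fun a b => hG'.intervalIntegrable a b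
  -- `G` is a primitive of `G'` in the Banach space `C(X, ℝ)`. This may be checked through the point
  -- evaluations, which commute with the Bochner integral.
  have heq : G = fun s => G t + ∫ r in t..s, G' r := by
    funext s
    ext x
    have h1 : (∫ r in t..s, G' r) x = ∫ r in t..s, G' r x :=
      ((ContinuousMap.evalCLM ℝ x).intervalIntegral_comp_comm (hint t s)).symm
    have hc : Continuous fun r => G' r x := (ContinuousMap.evalCLM ℝ x).continuous.comp hG'
    have h2 := intervalIntegral.integral_eq_sub_of_hasDerivAt (fun r _ => h r x)
      (hc.intervalIntegrable t s)
    rw [ContinuousMap.add_apply, h1, h2]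
    ring
  rw [heq]
  exact (intervalIntegral.integral_hasDerivAt_right (hint t t)
    (hG'.stronglyMeasurableAtFilter _ _) hG'.continuousAt).const_add _

/-! ### Integration by parts -/

theorem integrable_of_continuous {E : Type*} [NormedAddCommGroup E] {f : Torus d → E}
    (hf : Continuous f) : Integrable f :=
  hf.integrable_of_hasCompactSupport (HasCompactSupport.of_compactSpace f)

theorem integrable_mul_continuous {w : Torus d → ℝ} (hw : Integrable w) {F : Torus d → ℝ}
    (hF : Continuous F) : Integrable fun u => w u * F u := by
  obtain ⟨C, hC⟩ := isCompact_univ.exists_bound_of_continuousOn hF.continuousOn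
  exact hw.mul_bdd hF.aestronglyMeasurable (c := C) (ae_of_all _ fun u => hC u (Set.mem_univ u))

/-- The functional `F ↦ ∫ w F du` on the continuous functions, for an integrable `w`. -/
noncomputable def densityCLM (w : Torus d → ℝ) (hw : Integrable w) : C(Torus d, ℝ) →L[ℝ] ℝ :=
  LinearMap.mkContinuous
    { toFun := fun F => ∫ u, w u * F u
      map_add' := fun F G => by
        simp only [ContinuousMap.add_apply, mul_add]
        exact integral_add (integrable_mul_continuous hw F.continuous)
          (integrable_mul_continuous hw G.continuous)
      map_smul' := fun c F => by
        simp only [ContinuousMap.smul_apply, smul_eq_mul, mul_left_comm _ c, RingHom.id_apply]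
        exact integral_const_mul _ _ }
    (∫ u, |w u|) fun F => by
      refine (norm_integral_le_integral_norm _).trans ?_
      rw [← integral_mul_const]
      refine integral_mono (integrable_mul_continuous hw F.continuous).norm
        (hw.abs.mul_const _) fun u => ?_
      simp only [norm_mul, Real.norm_eq_abs]
      exact mul_le_mul_of_nonneg_left (F.norm_coe_le_norm u) (abs_nonneg _)

@[simp] theorem densityCLM_apply (w : Torus d → ℝ) (hw : Integrable w) (F : C(Torus d, ℝ)) :
    densityCLM w hw F = ∫ u, w u * F u := rfl

/-- By translation invariance the integral of a translate of `h` does not depend on the shift, so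
its derivative at shift zero vanishes. `hasDerivAt_curve` lets the derivative pass under the
integral. -/
theorem integral_pderiv {h : Torus d → ℝ} (hh : IsC 1 h) (i : Fin d) :
    ∫ u, pderiv i h u = 0 := by
  have hp : Continuous (pderiv i h) := (IsC.pderiv (n := 0) hh i).continuous
  have hs : Continuous fun s : ℝ => (Pi.single i (s : UnitAddCircle) : Torus d) := by
    simp_rw [← proj_single]
    exact continuous_proj.comp (continuous_single (A := fun _ : Fin d => ℝ) i)
  have key := (densityCLM (d := d) (fun _ => 1) (integrable_const 1)).hasFDerivAt.comp_hasDerivAt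
    (0 : ℝ) (hasDerivAt_curve
      (G := fun s => translate (Pi.single i (s : UnitAddCircle)) ⟨h, hh.continuous⟩)
      (G' := fun s => translate (Pi.single i (s : UnitAddCircle)) ⟨pderiv i h, hp⟩)
      ((continuous_translate _).comp hs) (fun t x => hh.hasDerivAt_single i x t) 0)
  simp only [Function.comp_def, densityCLM_apply, translate_apply, ContinuousMap.coe_mk, one_mul,
    integral_add_right_eq_self] at key
  simpa using (key.unique (hasDerivAt_const _ _))

/-- Integration by parts on the torus. -/
theorem integral_mul_pderiv {f g : Torus d → ℝ} (hf : IsC 1 f) (hg : IsC 1 g) (i : Fin d) :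
    ∫ u, f u * pderiv i g u = -∫ u, pderiv i f u * g u := by
  have h := integral_pderiv (hf.mul hg) i
  simp only [pderiv_mul hf hg] at h
  rw [integral_add] at h
  · linarith
  · exact integrable_of_continuous ((IsC.pderiv (n := 0) hf i).continuous.mul hg.continuous)
  · exact integrable_of_continuous (hf.continuous.mul (IsC.pderiv (n := 0) hg i).continuous)

theorem IsC.continuous_div {F : Torus d → Fin d → ℝ} (hF : ∀ i, IsC 1 fun u => F u i) :
    Continuous (Torus.div F) := by
  unfold Torus.div
  exact continuous_finsetSum _ fun i _ => (IsC.pderiv (n := 0) (hF i) i).continuous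

theorem integral_mul_div {f : Torus d → ℝ} (hf : IsC 1 f) {F : Torus d → Fin d → ℝ}
    (hF : ∀ i, IsC 1 fun u => F u i) :
    ∫ u, f u * Torus.div F u = -∫ u, ∑ i, pderiv i f u * F u i := by
  simp only [Torus.div, Finset.mul_sum]
  rw [integral_finsetSum, integral_finsetSum, ← Finset.sum_neg_distrib]
  · exact Finset.sum_congr rfl fun i _ => integral_mul_pderiv hf (hF i) i
  · exact fun i _ => integrable_of_continuous
      ((IsC.pderiv (n := 0) hf i).continuous.mul (hF i).continuous)
  · exact fun i _ => integrable_of_continuous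
      (hf.continuous.mul (IsC.pderiv (n := 0) (hF i) i).continuous)

end Torus

/-! ### Signed measures and profiles as functionals on the continuous functions. -/

namespace MeanCurrent
open Torus

variable {d : ℕ}

/-! ### Pairings -/

instance isFiniteMeasure_variation {X : Type*} [MeasurableSpace X] (μ : SignedMeasure X) :
    IsFiniteMeasure μ.variation := by
  rw [← SignedMeasure.totalVariation_eq_variation]
  infer_instance

theorem integrable_variation (μ : SignedMeasure (Torus d)) {F : Torus d → ℝ}
    (hF : Continuous F) : μ.Integrable F :=
  hF.integrable_of_hasCompactSupport (HasCompactSupport.of_compactSpace _)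

/-- The pairing with a signed measure as a functional on the continuous functions. -/
noncomputable def pairCLM (μ : SignedMeasure (Torus d)) : C(Torus d, ℝ) →L[ℝ] ℝ :=
  LinearMap.mkContinuous
    { toFun := fun F => pair μ F
      map_add' := fun F G => VectorMeasure.integral_add (integrable_variation μ F.continuous)
          (integrable_variation μ G.continuous)
      map_smul' := fun c F => VectorMeasure.integral_smul F μ _ c }
    (‖ContinuousLinearMap.lsmul ℝ ℝ (E := ℝ)‖ * μ.variation.real Set.univ) fun F => by
      refine (VectorMeasure.norm_integral_le_of_norm_le_const
        (ae_of_all _ fun u => F.norm_coe_le_norm u)).trans (le_of_eq ?_)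
      ring

@[simp] theorem pairCLM_apply (μ : SignedMeasure (Torus d)) (F : C(Torus d, ℝ)) :
    pairCLM μ F = pair μ F := rfl

theorem pair_toSignedMeasure (ν : Measure (Torus d)) [IsFiniteMeasure ν] (F : Torus d → ℝ) :
    pair ν.toSignedMeasure F = ∫ u, F u ∂ν := by
  have h : (ContinuousLinearMap.lsmul ℝ ℝ (E := ℝ)) = (ContinuousLinearMap.lsmul ℝ ℝ).flip := by
    ext; simp
  rw [pair, h]
  exact VectorMeasure.integral_toSignedMeasure

theorem pair_add_measure (μ ν : SignedMeasure (Torus d)) {F : Torus d → ℝ} (hF : Continuous F) :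
    pair (μ + ν) F = pair μ F + pair ν F :=
  VectorMeasure.integral_add_vectorMeasure (integrable_variation μ hF) (integrable_variation ν hF)

theorem pair_sub_measure (μ ν : SignedMeasure (Torus d)) {F : Torus d → ℝ} (hF : Continuous F) :
    pair (μ - ν) F = pair μ F - pair ν F :=
  VectorMeasure.integral_sub_vectorMeasure (integrable_variation μ hF) (integrable_variation ν hF)

theorem pair_smul_measure (c : ℝ) (μ : SignedMeasure (Torus d)) (F : Torus d → ℝ) :
    pair (c • μ) F = c * pair μ F :=
  VectorMeasure.integral_smul_vectorMeasure F c

@[simp] theorem pair_zero_measure (F : Torus d → ℝ) : pair 0 F = 0 := by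
  simp [pair]

@[simp] theorem pair_zero (μ : SignedMeasure (Torus d)) : pair μ (fun _ => 0) = 0 := by
  simp [pair]

theorem pair_withDensity {w : Torus d → ℝ} (hw : Integrable w) {F : Torus d → ℝ}
    (hF : Continuous F) : pair (volume.withDensityᵥ w) F = ∫ u, w u * F u := by
  have h1 := isFiniteMeasure_withDensity_ofReal hw.2
  have h2 := isFiniteMeasure_withDensity_ofReal hw.neg.2
  have key : ∀ v : Torus d → ℝ, Integrable v →
      ∫ u, F u ∂(volume.withDensity fun u => ENNReal.ofReal (v u)) = ∫ u, max (v u) 0 * F u := by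
    intro v hv
    rw [integral_withDensity_eq_integral_toReal_smul₀ hv.1.aemeasurable.ennreal_ofReal
      (ae_of_all _ fun _ => ENNReal.ofReal_lt_top)]
    simp [ENNReal.toReal_ofReal']
  rw [withDensityᵥ_eq_withDensity_pos_part_sub_withDensity_neg_part hw]
  refine (pair_sub_measure _ _ hF).trans ?_
  rw [pair_toSignedMeasure, pair_toSignedMeasure, key _ hw]
  refine (congrArg _ (key _ hw.neg)).trans ?_
  rw [← integral_sub (integrable_mul_continuous hw.pos_part hF)
    (integrable_mul_continuous hw.neg.pos_part hF)]
  refine integral_congr_ae (ae_of_all _ fun u => ?_)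
  simp only [Pi.neg_apply, ← sub_mul]
  congr 1
  rcases le_total (w u) 0 with h | h <;> simp [h]

/-- A signed measure is determined by its pairings with continuous functions. -/
theorem signedMeasure_ext {μ ν : SignedMeasure (Torus d)}
    (h : ∀ F : C(Torus d, ℝ), pair μ F = pair ν F) : μ = ν := by
  rw [← μ.toSignedMeasure_toJordanDecomposition, ← ν.toSignedMeasure_toJordanDecomposition] at h ⊢
  set a := μ.toJordanDecomposition
  set b := ν.toJordanDecomposition
  simp only [JordanDecomposition.toSignedMeasure] at h ⊢
  -- The Jordan parts are compared crosswise, so that only positive finite measures occur; these are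
  -- separated by continuous functions.
  have key : a.posPart + b.negPart = b.posPart + a.negPart := by
    refine ext_of_forall_integral_eq_of_IsFiniteMeasure fun F => ?_
    have hi : ∀ (κ : Measure (Torus d)) [IsFiniteMeasure κ], Integrable F κ :=
      fun κ _ => F.integrable κ
    have h1 := h F.toContinuousMap
    simp only [BoundedContinuousFunction.coe_toContinuousMap] at h1
    rw [pair_sub_measure _ _ F.continuous, pair_sub_measure _ _ F.continuous] at h1
    simp only [pair_toSignedMeasure] at h1
    rw [integral_add_measure (hi _) (hi _), integral_add_measure (hi _) (hi _)]
    linarith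
  rw [sub_eq_sub_iff_add_eq_add, ← Measure.toSignedMeasure_add, ← Measure.toSignedMeasure_add]
  simp only [key]

theorem vpair_zero (J : Current d) : vpair J (fun _ _ => 0) = 0 := by
  simp [vpair]

/-! ### Topology -/

theorem continuous_pair (F : C(Torus d, ℝ)) :
    Continuous fun μ : SignedMeasure (Torus d) => pair μ F :=
  (continuous_apply (A := fun _ : C(Torus d, ℝ) => ℝ) F).comp
    (continuous_induced_dom (f := fun (μ : SignedMeasure (Torus d)) (F : C(Torus d, ℝ)) => pair μ F))

theorem continuous_vpair {F : Torus d → Fin d → ℝ} (hF : ∀ i, Continuous fun u => F u i) :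
    Continuous fun J : Current d => vpair J F :=
  continuous_finsetSum _ fun i _ =>
    (continuous_pair ⟨_, hF i⟩).comp (continuous_apply i)

theorem continuous_dpair (F : C(Torus d, ℝ)) :
    Continuous fun ρ : Profile d => dpair ρ F :=
  (continuous_apply (A := fun _ : C(Torus d, ℝ) => ℝ) F).comp
    (continuous_induced_dom (f := fun (ρ : Profile d) (F : C(Torus d, ℝ)) => dpair ρ F))

theorem continuous_current_iff {X : Type*} [TopologicalSpace X] {f : X → Current d} :
    Continuous f ↔ ∀ i (F : C(Torus d, ℝ)), Continuous fun x => pair (f x i) F := by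
  rw [continuous_pi_iff]
  refine forall_congr' fun i => ?_
  rw [continuous_induced_rng, continuous_pi_iff]
  rfl

theorem continuous_profile_iff {X : Type*} [TopologicalSpace X] {f : X → Profile d} :
    Continuous f ↔ ∀ (F : C(Torus d, ℝ)), Continuous fun x => dpair (f x) F := by
  rw [continuous_induced_rng, continuous_pi_iff]
  rfl

/-! ### Profiles and divergence free measures -/

theorem Profile.integrable (ρ : Profile d) : Integrable (ρ : Torus d → ℝ) :=
  Integrable.of_bound ρ.2.1.aestronglyMeasurable 1 (ae_of_all _ fun u => by
    rw [Real.norm_eq_abs, abs_le]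
    constructor <;> linarith [(ρ.2.2 u).1, (ρ.2.2 u).2])

end MeanCurrent

/-! ### Mollification of functionals by trigonometric kernels. -/

namespace Torus

variable {d : ℕ}

instance isNegInvariant_volume : (volume : Measure (Torus d)).IsNegInvariant :=
  Measure.IsAddHaarMeasure.isNegInvariant_of_regular _

/-! ### Separable kernels -/

/-- `K(u, v)` is a finite sum of products `a(u) b(v)` with smooth `a` and continuous `b`. -/
def IsSeparable (K : Torus d → Torus d → ℝ) : Prop :=
  ∃ (ι : Type) (_ : Fintype ι) (a b : ι → Torus d → ℝ), (∀ p n, IsC n (a p)) ∧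
    (∀ p, Continuous (b p)) ∧ ∀ u v, K u v = ∑ p, a p u * b p v

theorem isSeparable_mul {a b : Torus d → ℝ} (ha : ∀ n, IsC n a) (hb : Continuous b) :
    IsSeparable fun u v => a u * b v :=
  ⟨Unit, inferInstance, fun _ => a, fun _ => b, fun _ => ha, fun _ => hb, by simp⟩

theorem isSeparable_const (c : ℝ) : IsSeparable fun _ _ : Torus d => c := by
  simpa using isSeparable_mul (d := d) (a := fun _ => c) (b := fun _ => 1)
    (fun n => isC_const n c) continuous_const

theorem IsSeparable.add {K L : Torus d → Torus d → ℝ} (hK : IsSeparable K) (hL : IsSeparable L) :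
    IsSeparable fun u v => K u v + L u v := by
  obtain ⟨ι, _, a, b, ha, hb, h⟩ := hK
  obtain ⟨κ, _, a', b', ha', hb', h'⟩ := hL
  refine ⟨ι ⊕ κ, inferInstance, Sum.elim a a', Sum.elim b b', ?_, ?_, fun u v => ?_⟩
  · rintro (p | p) <;> simp [ha, ha']
  · rintro (p | p) <;> simp [hb, hb']
  · simp [h, h']

theorem IsSeparable.mul {K L : Torus d → Torus d → ℝ} (hK : IsSeparable K) (hL : IsSeparable L) :
    IsSeparable fun u v => K u v * L u v := by
  obtain ⟨ι, _, a, b, ha, hb, h⟩ := hK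
  obtain ⟨κ, _, a', b', ha', hb', h'⟩ := hL
  refine ⟨ι × κ, inferInstance, fun p u => a p.1 u * a' p.2 u, fun p v => b p.1 v * b' p.2 v,
    fun p n => (ha p.1 n).mul (ha' p.2 n), fun p => (hb p.1).mul (hb' p.2), fun u v => ?_⟩
  simp only [h, h', Finset.sum_mul_sum, Fintype.sum_prod_type]
  exact Finset.sum_congr rfl fun _ _ => Finset.sum_congr rfl fun _ _ => by ring

theorem isSeparable_sum {ι : Type*} (s : Finset ι) {K : ι → Torus d → Torus d → ℝ}
    (hK : ∀ i, IsSeparable (K i)) : IsSeparable fun u v => ∑ i ∈ s, K i u v := by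
  classical
  induction s using Finset.induction_on with
  | empty => simpa using isSeparable_const 0
  | insert i s hi ih => simpa [Finset.sum_insert hi] using (hK i).add ih

theorem IsSeparable.pow {K : Torus d → Torus d → ℝ} (hK : IsSeparable K) (n : ℕ) :
    IsSeparable fun u v => K u v ^ n := by
  induction n with
  | zero => simpa using isSeparable_const 1
  | succ n ih => simpa [pow_succ] using ih.mul hK

/-! ### Mollifiers -/

/-- A probability density `k` for which the kernel `k(u - v)` is separable. -/
structure IsMollifier (k : C(Torus d, ℝ)) : Prop where
  nonneg : ∀ u, 0 ≤ k u
  integral_eq_one : ∫ u, k u = 1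
  separable : IsSeparable fun u v => k (u - v)

/-- The function `v ↦ k(u - v)`. -/
def reflect (k : C(Torus d, ℝ)) (u : Torus d) : C(Torus d, ℝ) :=
  k.comp ⟨fun v => u - v, by fun_prop⟩

/-- The convolution of `k` with a functional on the continuous functions. -/
def mollify (k : C(Torus d, ℝ)) (l : C(Torus d, ℝ) →L[ℝ] ℝ) (u : Torus d) : ℝ := l (reflect k u)

/-- A kernel of finite rank turns the convolution with any functional into a finite combination of
the smooth `a p`. Smoothness and Fubini then reduce to linearity. -/
theorem IsMollifier.mollify_eq {k : C(Torus d, ℝ)} (hk : IsMollifier k) :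
    ∃ (ι : Type) (_ : Fintype ι) (a b : ι → C(Torus d, ℝ)), (∀ p n, IsC n (a p)) ∧
      (∀ u v, k (u - v) = ∑ p, a p u * b p v) ∧
      ∀ l u, mollify k l u = ∑ p, a p u * l (b p) := by
  obtain ⟨ι, _, a, b, ha, hb, h⟩ := hk.separable
  refine ⟨ι, inferInstance, fun p => ⟨a p, (ha p 0).continuous⟩, fun p => ⟨b p, hb p⟩, ha, h,
    fun l u => ?_⟩
  have : reflect k u = ∑ p, a p u • (⟨b p, hb p⟩ : C(Torus d, ℝ)) := by
    ext v; simp [reflect, h, ContinuousMap.sum_apply]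
  simp [mollify, this, map_sum]

theorem IsMollifier.isC {k : C(Torus d, ℝ)} (hk : IsMollifier k) (l : C(Torus d, ℝ) →L[ℝ] ℝ)
    (n : ℕ) : IsC n (mollify k l) := by
  obtain ⟨ι, _, a, b, ha, -, h⟩ := hk.mollify_eq
  simp_rw [show mollify k l = fun u => ∑ p, a p u * l (b p) from funext (h l)]
  exact isC_sum _ fun p _ => (ha p n).mul (isC_const n _)

theorem continuous_smul_translate (k F : C(Torus d, ℝ)) :
    Continuous fun y => k y • translate y F :=
  k.continuous.smul (continuous_translate F)

/-- Both sides are `l` applied to the function `∫ k(y) F(· + y) dy`. On the left this function is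
expanded in the finitely many `b p`; on the right `l` passes under the Bochner integral. -/
theorem IsMollifier.integral_mollify {k : C(Torus d, ℝ)} (hk : IsMollifier k)
    (l : C(Torus d, ℝ) →L[ℝ] ℝ) (F : C(Torus d, ℝ)) :
    ∫ u, mollify k l u * F u = ∫ y, k y * l (translate y F) := by
  obtain ⟨ι, _, a, b, ha, hk', h⟩ := hk.mollify_eq
  have hint := integrable_of_continuous (continuous_smul_translate k F)
  have h1 : ∫ y, k y • translate y F = ∑ p, (∫ u, a p u * F u) • b p := by
    ext v
    rw [ContinuousMap.integral_apply hint]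
    simp only [ContinuousMap.smul_apply, translate_apply, smul_eq_mul, ContinuousMap.sum_apply]
    have : ∫ y, k y * F (v + y) = ∫ u, k (u - v) * F u := by
      rw [← integral_add_right_eq_self (fun u => k (u - v) * F u) v]
      simp [add_comm v]
    rw [this]
    simp_rw [hk', Finset.sum_mul]
    rw [integral_finsetSum _ fun p _ => integrable_of_continuous (by fun_prop)]
    refine Finset.sum_congr rfl fun p _ => ?_
    rw [← integral_mul_const]
    congr 1; ext u; ring
  calc ∫ u, mollify k l u * F u = ∑ p, (∫ u, a p u * F u) * l (b p) := by
        simp_rw [h, Finset.sum_mul]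
        rw [integral_finsetSum _ fun p _ => integrable_of_continuous (by fun_prop)]
        refine Finset.sum_congr rfl fun p _ => ?_
        rw [← integral_mul_const]
        congr 1; ext u; ring
    _ = l (∫ y, k y • translate y F) := by rw [h1]; simp [map_sum]
    _ = ∫ y, k y * l (translate y F) := by
        rw [← l.integral_comp_comm hint]; simp

theorem IsMollifier.mollify_density_mem {k : C(Torus d, ℝ)} (hk : IsMollifier k)
    {ρ : Torus d → ℝ} (hρ : Integrable ρ) (h01 : ∀ u, 0 ≤ ρ u ∧ ρ u ≤ 1) (u : Torus d) :
    0 ≤ mollify k (densityCLM ρ hρ) u ∧ mollify k (densityCLM ρ hρ) u ≤ 1 := by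
  have h1 : ∫ v, k (u - v) = 1 := by
    rw [integral_sub_left_eq_self (fun v => k v) volume u, hk.integral_eq_one]
  simp only [mollify, densityCLM_apply, reflect, ContinuousMap.comp_apply, ContinuousMap.coe_mk]
  refine ⟨integral_nonneg fun v => mul_nonneg (h01 v).1 (hk.nonneg _), ?_⟩
  refine le_of_le_of_eq ?_ h1
  refine integral_mono (integrable_mul_continuous hρ (by fun_prop))
    (integrable_of_continuous (by fun_prop)) fun v => ?_
  exact mul_le_of_le_one_left (hk.nonneg _) (h01 v).2

/-! ### Concentrating mollifiers -/

/-- The function `1 + ∑ᵢ (1 + cos 2πuᵢ)`. -/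
noncomputable def peak (d : ℕ) : C(Torus d, ℝ) where
  toFun u := 1 + ∑ i, (1 + (AddCircle.toCircle (u i) : ℂ).re)
  continuous_toFun := by
    have := AddCircle.continuous_toCircle (T := (1 : ℝ))
    fun_prop

theorem re_toCircle_le (x : UnitAddCircle) : (AddCircle.toCircle x : ℂ).re ≤ 1 :=
  (Complex.re_le_norm _).trans (Circle.norm_coe _).le

theorem neg_one_le_re_toCircle (x : UnitAddCircle) : -1 ≤ (AddCircle.toCircle x : ℂ).re :=
  (abs_le.1 ((Complex.abs_re_le_norm _).trans_eq (Circle.norm_coe _))).1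

theorem re_toCircle_lt {x : UnitAddCircle} (hx : x ≠ 0) : (AddCircle.toCircle x : ℂ).re < 1 := by
  refine lt_of_le_of_ne (re_toCircle_le x) fun h => hx ?_
  apply AddCircle.injective_toCircle one_ne_zero
  rw [AddCircle.toCircle_zero]
  have h2 : Complex.normSq (AddCircle.toCircle x : ℂ) = 1 := Circle.normSq_coe _
  rw [Complex.normSq_apply, h] at h2
  apply Circle.ext
  apply Complex.ext
  · simpa using h
  · simpa using h2

theorem peak_pos (u : Torus d) : 0 < peak d u := by
  have : 0 ≤ ∑ i, (1 + (AddCircle.toCircle (u i) : ℂ).re) :=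
    Finset.sum_nonneg fun i _ => by linarith [neg_one_le_re_toCircle (u i)]
  simp only [peak, ContinuousMap.coe_mk]
  linarith

/-- The strict unique maximum is what makes the normalized powers concentrate at `0`. -/
theorem peak_lt {u : Torus d} (hu : u ≠ 0) : peak d u < peak d 0 := by
  obtain ⟨i, hi⟩ := Function.ne_iff.1 hu
  simp only [peak, ContinuousMap.coe_mk]
  gcongr 1 + ?_
  refine Finset.sum_lt_sum (fun i _ => ?_) ⟨i, Finset.mem_univ i, ?_⟩
  · simpa using re_toCircle_le (u i)
  · simpa using re_toCircle_lt hi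

theorem isC_re_toCircle (i : Fin d) (n : ℕ) :
    IsC n fun u : Torus d => (AddCircle.toCircle (u i) : ℂ).re := by
  have : (fun x : Fin d → ℝ => (AddCircle.toCircle (proj x i) : ℂ).re)
      = fun x => Real.cos (2 * Real.pi * x i) := by
    ext x
    rw [← Complex.exp_ofReal_mul_I_re]
    simp [proj, AddCircle.toCircle_apply_mk, Circle.coe_exp]
  unfold IsC
  rw [this]
  fun_prop

theorem isC_im_toCircle (i : Fin d) (n : ℕ) :
    IsC n fun u : Torus d => (AddCircle.toCircle (u i) : ℂ).im := by
  have : (fun x : Fin d → ℝ => (AddCircle.toCircle (proj x i) : ℂ).im)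
      = fun x => Real.sin (2 * Real.pi * x i) := by
    ext x
    rw [← Complex.exp_ofReal_mul_I_im]
    simp [proj, AddCircle.toCircle_apply_mk, Circle.coe_exp]
  unfold IsC
  rw [this]
  fun_prop

/-- The addition formula for the cosine separates the variables; sums, products and hence powers
remain separable. -/
theorem isSeparable_peak : IsSeparable fun u v : Torus d => peak d (u - v) := by
  have h : ∀ u v : Torus d, peak d (u - v) = 1 + ∑ i,
      (1 + ((AddCircle.toCircle (u i) : ℂ).re * (AddCircle.toCircle (v i) : ℂ).re
        + (AddCircle.toCircle (u i) : ℂ).im * (AddCircle.toCircle (v i) : ℂ).im)) := by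
    intro u v
    simp only [peak, ContinuousMap.coe_mk]
    congr 1
    refine Finset.sum_congr rfl fun i _ => ?_
    have : AddCircle.toCircle ((u - v) i)
        = AddCircle.toCircle (u i) * (AddCircle.toCircle (v i))⁻¹ := by
      rw [← AddCircle.toCircle_neg, ← AddCircle.toCircle_add, ← sub_eq_add_neg]
      rfl
    rw [this, Circle.coe_mul, Circle.coe_inv_eq_conj, Complex.mul_re, Complex.conj_re,
      Complex.conj_im]
    ring
  simp_rw [h]
  refine (isSeparable_const 1).add (isSeparable_sum _ fun i => (isSeparable_const 1).add
    (IsSeparable.add ?_ ?_))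
  · exact isSeparable_mul (isC_re_toCircle i) (isC_re_toCircle i 0).continuous
  · exact isSeparable_mul (isC_im_toCircle i) (isC_im_toCircle i 0).continuous

/-- The normalized `n`-th power of `peak d`. -/
noncomputable def powerMollifier (d n : ℕ) : C(Torus d, ℝ) :=
  (∫ u, peak d u ^ n)⁻¹ • peak d ^ n

theorem integral_peak_pow_pos (n : ℕ) : 0 < ∫ u, peak d u ^ n := by
  have hc : Continuous fun u => peak d u ^ n := by fun_prop
  exact hc.integral_pos_of_hasCompactSupport_nonneg_nonzero
    (HasCompactSupport.of_compactSpace _) (fun u => (pow_pos (peak_pos u) n).le)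
    (x := 0) (pow_pos (peak_pos 0) n).ne'

theorem isMollifier_powerMollifier (n : ℕ) : IsMollifier (powerMollifier d n) where
  nonneg u := by
    simpa [powerMollifier] using
      mul_nonneg (inv_nonneg.2 (integral_peak_pow_pos n).le) (pow_pos (peak_pos u) n).le
  integral_eq_one := by
    simp only [powerMollifier, ContinuousMap.smul_apply, ContinuousMap.pow_apply, smul_eq_mul]
    rw [integral_const_mul, inv_mul_cancel₀ (integral_peak_pow_pos n).ne']
  separable := by
    simpa [powerMollifier] using (isSeparable_const (∫ u, peak d u ^ n)⁻¹).mul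
      (isSeparable_peak.pow n)

/-- Vector values are allowed because the lemma is also applied to the `L²`-valued map
`translateL2`. -/
theorem tendsto_integral_powerMollifier {E : Type*} [NormedAddCommGroup E] [NormedSpace ℝ E]
    [CompleteSpace E] {g : Torus d → E} (hg : Continuous g) :
    Tendsto (fun n => ∫ y, powerMollifier d n y • g y) atTop (𝓝 (g 0)) := by
  have := tendsto_setIntegral_pow_smul_of_unique_maximum_of_isCompact_of_continuousOn
    (μ := (volume : Measure (Torus d))) isCompact_univ (c := peak d) (x₀ := 0) (g := g)
    (peak d).continuous.continuousOn (fun y _ hy => peak_lt hy) (fun y _ => (peak_pos y).le)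
    (peak_pos 0) (by simp) hg.continuousOn
  simpa [powerMollifier, mul_smul, integral_smul] using this

end Torus

/-! ### From bounds on functionals to `L²` densities and profiles. -/

namespace Torus

variable {d : ℕ}

/-! ### Square integrable functions on the torus -/

/-- The inclusion of the continuous functions into `L²`. -/
noncomputable abbrev toL2 (d : ℕ) : C(Torus d, ℝ) →L[ℝ] Lp ℝ 2 (volume : Measure (Torus d)) :=
  ContinuousMap.toLp 2 volume ℝ

theorem denseRange_toL2 : DenseRange (toL2 d) :=
  ContinuousMap.toLp_denseRange ℝ volume ℝ (by simp)

theorem memLp_of_continuous {f : Torus d → ℝ} (hf : Continuous f) (p : ℝ≥0∞) : MemLp f p :=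
  hf.memLp_of_hasCompactSupport (HasCompactSupport.of_compactSpace f)

theorem toL2_eq (F : C(Torus d, ℝ)) : toL2 d F = (memLp_of_continuous F.continuous 2).toLp F :=
  rfl

theorem inner_toLp {v w : Torus d → ℝ} (hv : MemLp v 2) (hw : MemLp w 2) :
    inner ℝ (hv.toLp v) (hw.toLp w) = ∫ u, v u * w u := by
  rw [L2.inner_def]
  refine integral_congr_ae ?_
  filter_upwards [hv.coeFn_toLp, hw.coeFn_toLp] with u h1 h2
  rw [h1, h2]
  simp [mul_comm]

theorem norm_sq_toLp {w : Torus d → ℝ} (hw : MemLp w 2) :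
    ‖hw.toLp w‖ ^ 2 = ∫ u, w u ^ 2 := by
  rw [← real_inner_self_eq_norm_sq, inner_toLp]
  simp [sq]

theorem norm_toL2_sq (F : C(Torus d, ℝ)) : ‖toL2 d F‖ ^ 2 = ∫ u, F u ^ 2 := by
  rw [toL2_eq, norm_sq_toLp]

theorem inner_toLp_toL2 {w : Torus d → ℝ} (hw : MemLp w 2) (F : C(Torus d, ℝ)) :
    inner ℝ (hw.toLp w) (toL2 d F) = ∫ u, w u * F u := by
  rw [toL2_eq, inner_toLp]

/-- A functional on the continuous functions that is bounded in `L²` has an `L²` density. -/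
theorem exists_density_of_bound (l : C(Torus d, ℝ) →ₗ[ℝ] ℝ) {C : ℝ}
    (h : ∀ F, l F ^ 2 ≤ C * ∫ u, F u ^ 2) :
    ∃ w : Torus d → ℝ, MemLp w 2 ∧ ∀ F, l F = ∫ u, w u * F u := by
  have hb : ∀ F, ‖l F‖ ≤ √C * ‖(toL2 d).toLinearMap F‖ := by
    intro F
    have h1 := h F
    rw [← norm_toL2_sq] at h1
    rw [Real.norm_eq_abs, ← Real.sqrt_sq_eq_abs]
    refine (Real.sqrt_le_sqrt h1).trans (le_of_eq ?_)
    rw [Real.sqrt_mul' _ (sq_nonneg _), Real.sqrt_sq (norm_nonneg _)]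
    rfl
  -- The functional extends from the dense image of the continuous functions to `L²`, where the
  -- Riesz representation supplies the density.
  set L := l.extendOfNorm (toL2 d).toLinearMap
  have hL : ∀ F, L (toL2 d F) = l F := fun F =>
    LinearMap.extendOfNorm_eq denseRange_toL2 ⟨√C, hb⟩ F
  set w := (InnerProductSpace.toDual ℝ _).symm L
  refine ⟨w, Lp.memLp w, fun F => ?_⟩
  rw [← hL, ← inner_toLp_toL2 (Lp.memLp w), Lp.toLp_coeFn]
  exact (InnerProductSpace.toDual_symm_apply).symm

/-- The positive part is continuous on `L²`, so the hypothesis extends from positive parts of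
continuous functions to all positive parts. Testing with the positive part of `-w` gives `-∫ (w⁻)² ≥
0`. -/
theorem ae_nonneg_of_forall_integral {w : Torus d → ℝ} (hw : MemLp w 2)
    (h : ∀ F : C(Torus d, ℝ), (∀ u, 0 ≤ F u) → 0 ≤ ∫ u, w u * F u) : ∀ᵐ u, 0 ≤ w u := by
  set f := hw.toLp w
  have key : ∀ φ : Lp ℝ 2 (volume : Measure (Torus d)), 0 ≤ inner ℝ f (Lp.posPart φ) := by
    intro φ
    refine denseRange_toL2.induction_on (p := fun φ => 0 ≤ inner ℝ f (Lp.posPart φ)) φ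
      (isClosed_le continuous_const (continuous_const.inner Lp.continuous_posPart)) fun F => ?_
    have h1 : Lp.posPart (toL2 d F) = toL2 d (F ⊔ 0) := by
      refine Lp.ext ?_
      filter_upwards [Lp.coeFn_posPart (toL2 d F), ContinuousMap.coeFn_toLp (p := 2) (𝕜 := ℝ)
        volume F, ContinuousMap.coeFn_toLp (p := 2) (𝕜 := ℝ) volume (F ⊔ 0)] with u h1 h2 h3
      rw [h1, h3, h2]
      simp
    rw [h1, inner_toLp_toL2]
    exact h _ fun u => by simp
  have h2 := key (-f)
  rw [L2.inner_def] at h2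
  have h3 : ∀ᵐ u, (inner ℝ (f u) ((Lp.posPart (-f) : Lp ℝ 2 (volume : Measure (Torus d))) u) : ℝ)
      = - max (-w u) 0 ^ 2 := by
    filter_upwards [Lp.coeFn_posPart (-f), Lp.coeFn_neg f, hw.coeFn_toLp] with u h1 h2 h3
    rw [h1, h2, Pi.neg_apply, h3]
    rcases le_total (w u) 0 with h | h <;> simp [h, sq]
  rw [integral_congr_ae h3, integral_neg] at h2
  have h4 : ∫ u, max (-w u) 0 ^ 2 = 0 :=
    le_antisymm (by linarith) (integral_nonneg fun u => sq_nonneg _)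
  have h5 : Integrable fun u => max (-w u) 0 ^ 2 := (hw.neg.pos_part).integrable_sq
  rw [integral_eq_zero_iff_of_nonneg (fun u => sq_nonneg _) h5] at h4
  filter_upwards [h4] with u hu
  have : max (-w u) 0 = 0 := by simpa using hu
  have := le_max_left (-w u) 0
  linarith

/-- The variance of `|f|` under the probability measure `volume` is nonnegative. -/
theorem sq_integral_abs_le {f : Torus d → ℝ} (hf : Continuous f) :
    (∫ u, |f u|) ^ 2 ≤ ∫ u, f u ^ 2 := by
  have h := integral_nonneg (μ := (volume : Measure (Torus d)))
    (f := fun u => (|f u| - ∫ v, |f v|) ^ 2) fun u => sq_nonneg _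
  have h2 : ∀ u, (|f u| - ∫ v, |f v|) ^ 2
      = f u ^ 2 - 2 * (∫ v, |f v|) * |f u| + (∫ v, |f v|) ^ 2 := by
    intro u; rw [sub_sq, sq_abs]; ring
  simp_rw [h2] at h
  rw [integral_add, integral_sub, integral_const_mul] at h
  · simp at h
    nlinarith
  all_goals exact integrable_of_continuous (by fun_prop)

/-! ### Mollification in `L²` -/

/-- The translate of an element of `L²`. -/
noncomputable def translateL2 (f : Lp ℝ 2 (volume : Measure (Torus d))) (y : Torus d) :
    Lp ℝ 2 (volume : Measure (Torus d)) :=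
  Lp.compMeasurePreserving (fun u => u - y) (measurePreserving_sub_right volume y) f

theorem continuous_translateL2 (f : Lp ℝ 2 (volume : Measure (Torus d))) :
    Continuous (translateL2 f) := by
  let g : C(Torus d, C(Torus d, Torus d)) :=
    (ContinuousMap.mk (fun p : Torus d × Torus d => p.2 - p.1) (by fun_prop)).curry
  exact continuous_const.compMeasurePreservingLp g.continuous
    (fun y => measurePreserving_sub_right volume y) (by simp)

theorem translateL2_zero (f : Lp ℝ 2 (volume : Measure (Torus d))) : translateL2 f 0 = f := by
  refine Lp.ext ?_
  filter_upwards [Lp.coeFn_compMeasurePreserving f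
    (measurePreserving_sub_right volume (0 : Torus d))] with u hu
  rw [translateL2, hu]
  simp

theorem inner_translateL2 {w : Torus d → ℝ} (hw : MemLp w 2) (y : Torus d) (F : C(Torus d, ℝ)) :
    inner ℝ (translateL2 (hw.toLp w) y) (toL2 d F) = ∫ u, w u * translate y F u := by
  have h := hw.comp_measurePreserving (measurePreserving_sub_right volume y)
  rw [translateL2, Lp.toLp_compMeasurePreserving hw, inner_toLp_toL2 h,
    ← integral_add_right_eq_self _ y]
  simp

/-- As an average of translates in `L²`, the mollification converges in `L²` by continuity of
translations and concentration of the kernel. The identity is tested against the dense set of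
continuous functions. -/
theorem IsMollifier.toL2_mollify {k : C(Torus d, ℝ)} (hk : IsMollifier k) {w : Torus d → ℝ}
    (hw : MemLp w 2) (hi : Integrable w) :
    toL2 d ⟨mollify k (densityCLM w hi), (hk.isC _ 0).continuous⟩
      = ∫ y, k y • translateL2 (hw.toLp w) y := by
  refine denseRange_toL2.eq_of_inner_left ℝ fun F => ?_
  have hint : Integrable fun y => k y • translateL2 (hw.toLp w) y :=
    integrable_of_continuous (k.continuous.smul (continuous_translateL2 _))
  rw [toL2_eq, inner_toLp_toL2]
  simp only [ContinuousMap.coe_mk]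
  rw [hk.integral_mollify, real_inner_comm, ← integral_inner hint]
  refine integral_congr_ae (ae_of_all _ fun y => ?_)
  simp only
  rw [inner_smul_right, real_inner_comm, inner_translateL2, densityCLM_apply]

theorem tendsto_integral_sq_mollify_sub {w : Torus d → ℝ} (hw : MemLp w 2) (hi : Integrable w) :
    Tendsto (fun n => ∫ u, (mollify (powerMollifier d n) (densityCLM w hi) u - w u) ^ 2)
      atTop (𝓝 0) := by
  have h1 := tendsto_integral_powerMollifier (continuous_translateL2 (hw.toLp w))
  rw [translateL2_zero] at h1
  have h2 := ((h1.sub_const (hw.toLp w)).norm.pow 2)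
  simp only [sub_self, norm_zero, ne_eq, OfNat.ofNat_ne_zero, not_false_eq_true, zero_pow] at h2
  refine h2.congr fun n => ?_
  rw [← (isMollifier_powerMollifier n).toL2_mollify hw hi, toL2_eq, ← MemLp.toLp_sub, norm_sq_toLp]
  rfl

end Torus

namespace MeanCurrent
open Torus

variable {d : ℕ}

/-! ### The space of profiles -/

/-- A positive functional that is dominated by Lebesgue measure is given by a profile. -/
theorem exists_profile (l : C(Torus d, ℝ) →ₗ[ℝ] ℝ)
    (h : ∀ F : C(Torus d, ℝ), (∀ u, 0 ≤ F u) → 0 ≤ l F ∧ l F ≤ ∫ u, F u) :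
    ∃ ρ : Profile d, ∀ F : C(Torus d, ℝ), dpair ρ F = l F := by
  -- Positivity on `|F| - F` and `|F| + F` gives `|l F| ≤ l |F|`; domination is then applied to
  -- `|F|`. The resulting `L¹` bound is stronger than the `L²` bound needed for a density.
  have habs : ∀ F : C(Torus d, ℝ), |l F| ≤ ∫ u, |F u| := by
    intro F
    have h1 := h (|F| - F) fun u => by simp [le_abs_self]
    have h2 := h (|F| + F) fun u => by simp; linarith [neg_abs_le (F u)]
    have h3 := h |F| fun u => by simp
    simp only [map_sub, map_add] at h1 h2
    have h4 : l |F| ≤ ∫ u, |F u| := by simpa using h3.2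
    rw [abs_le]
    constructor <;> linarith [h1.1, h2.1]
  obtain ⟨w, hw, hl⟩ := exists_density_of_bound l (C := 1) fun F => by
    rw [one_mul]
    refine le_trans ?_ (sq_integral_abs_le F.continuous)
    rw [← sq_abs]
    exact pow_le_pow_left₀ (abs_nonneg _) (habs F) 2
  have hi : Integrable w := hw.integrable (by norm_num)
  have h0 : ∀ᵐ u, 0 ≤ w u := ae_nonneg_of_forall_integral hw fun F hF => by
    rw [← hl]; exact (h F hF).1
  have h1 : ∀ᵐ u, 0 ≤ 1 - w u := by
    refine ae_nonneg_of_forall_integral ((memLp_const 1).sub hw) fun F hF => ?_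
    have := (h F hF).2
    rw [hl] at this
    simp only [sub_mul, one_mul]
    rw [integral_sub (integrable_of_continuous F.continuous)
      (integrable_mul_continuous hi F.continuous)]
    linarith
  have hm := hw.1.stronglyMeasurable_mk.measurable
  -- A profile must take values in `[0, 1]` everywhere, so a measurable representative is truncated;
  -- this changes it only on a null set.
  refine ⟨⟨fun u => max 0 (min 1 (hw.1.mk w u)), by fun_prop, fun u => ⟨by simp, by simp⟩⟩,
    fun F => ?_⟩
  rw [hl, dpair]
  refine integral_congr_ae ?_
  filter_upwards [h0, h1, hw.1.ae_eq_mk] with u a b c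
  simp only [← c]
  rw [min_eq_right (by linarith), max_eq_right a]

theorem dpair_bounds (ρ : Profile d) (F : C(Torus d, ℝ)) (hF : ∀ u, 0 ≤ F u) :
    0 ≤ dpair ρ F ∧ dpair ρ F ≤ ∫ u, F u :=
  ⟨integral_nonneg fun u => mul_nonneg (ρ.2.2 u).1 (hF u),
    integral_mono (integrable_mul_continuous ρ.integrable F.continuous)
      (integrable_of_continuous F.continuous) fun u =>
        mul_le_of_le_one_left (hF u) (ρ.2.2 u).2⟩

theorem abs_dpair_le (ρ : Profile d) (F : C(Torus d, ℝ)) : |dpair ρ F| ≤ ‖F‖ := by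
  have : ‖∫ u, ρ u * F u‖ ≤ ‖F‖ * (volume : Measure (Torus d)).real Set.univ := by
    refine norm_integral_le_of_norm_le_const (ae_of_all _ fun u => ?_)
    rw [norm_mul, Real.norm_of_nonneg (ρ.2.2 u).1]
    exact (mul_le_of_le_one_left (norm_nonneg _) (ρ.2.2 u).2).trans (F.norm_coe_le_norm u)
  simpa [dpair] using this

/-- As in Banach–Alaoglu, the pairings map the profiles into a product of compact intervals. By
`exists_profile` the image consists of the linear functionals with `0 ≤ l F ≤ ∫ F` for `F ≥ 0`,
which is a closed condition. The map is inducing, and this suffices although it is not injective. -/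
instance compactSpace_profile : CompactSpace (Profile d) := by
  have hind : IsInducing (fun (ρ : Profile d) (F : C(Torus d, ℝ)) => dpair ρ F) := ⟨rfl⟩
  rw [← isCompact_univ_iff, hind.isCompact_iff, Set.image_univ]
  have hK : IsCompact (Set.univ.pi fun F : C(Torus d, ℝ) => Set.Icc (-‖F‖) ‖F‖) :=
    isCompact_univ_pi fun F => isCompact_Icc
  refine hK.of_isClosed_subset ?_ ?_
  · have : Set.range (fun (ρ : Profile d) (F : C(Torus d, ℝ)) => dpair ρ F)
        = {l | (∀ F G, l (F + G) = l F + l G) ∧ (∀ (c : ℝ) F, l (c • F) = c * l F) ∧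
            ∀ F : C(Torus d, ℝ), (∀ u, 0 ≤ F u) → 0 ≤ l F ∧ l F ≤ ∫ u, F u} := by
      ext l
      constructor
      · rintro ⟨ρ, rfl⟩
        refine ⟨fun F G => (densityCLM ρ ρ.integrable).map_add F G,
          fun c F => (densityCLM ρ ρ.integrable).map_smul c F, dpair_bounds ρ⟩
      · rintro ⟨ha, hs, hb⟩
        obtain ⟨ρ, hρ⟩ := exists_profile ⟨⟨l, ha⟩, hs⟩ hb
        exact ⟨ρ, funext hρ⟩
    rw [this]
    simp only [Set.ofPred_and, Set.ofPred_forall]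
    refine ((isClosed_iInter fun F => isClosed_iInter fun G => ?_).inter
      ((isClosed_iInter fun c => isClosed_iInter fun F => ?_).inter
      (isClosed_iInter fun F => isClosed_iInter fun _ => ?_)))
    · exact isClosed_eq (by fun_prop) (by fun_prop)
    · exact isClosed_eq (by fun_prop) (by fun_prop)
    · exact (isClosed_le continuous_const (continuous_apply _)).inter
        (isClosed_le (continuous_apply _) continuous_const)
  · rintro _ ⟨ρ, rfl⟩ F -
    exact abs_le.1 (abs_dpair_le ρ F)

theorem isClosed_massProfiles (m : ℝ) : IsClosed (massProfiles d m) := by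
  have h : massProfiles d m = {ρ : Profile d | dpair ρ (1 : C(Torus d, ℝ)) = m} := by
    ext ρ; simp [massProfiles, dpair]
  rw [h]
  exact isClosed_eq (continuous_dpair 1) continuous_const

end MeanCurrent

/-! ### The dual bound `ActionLE` and what it implies for the current. -/

namespace MeanCurrent
open Torus

variable {d : ℕ}

/-! ### The affine functionals whose supremum is the static cost -/

/-- `⟨J, F⟩ - ½ ⟨ρ, ∇ · F⟩ - ½ ⟨(1 - 2 g) ρ + g², |F|²⟩`.  The supremum over `g` replaces
`(1 - 2 g) ρ + g²` by `χ(ρ)`. -/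
noncomputable def affineAction (J : Current d) (ρ : Torus d → ℝ) (F : Torus d → Fin d → ℝ)
    (g : Torus d → ℝ) : ℝ :=
  vpair J F - (1 / 2) * dpair ρ (fun u => Torus.div F u + (1 - 2 * g u) * ∑ i, F u i ^ 2)
    - (1 / 2) * ∫ u, g u ^ 2 * ∑ i, F u i ^ 2

/-- All affine functionals are at most `c` at `(J, ρ)`. -/
def ActionLE (c : ℝ) (J : Current d) (ρ : Torus d → ℝ) : Prop :=
  ∀ (F : Torus d → Fin d → ℝ) (g : Torus d → ℝ), (∀ i, IsC 1 fun u => F u i) → Continuous g →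
    affineAction J ρ F g ≤ c

theorem ActionLE.nonneg {c : ℝ} {J : Current d} {ρ : Torus d → ℝ} (h : ActionLE c J ρ) :
    0 ≤ c := by
  have := h (fun _ _ => 0) (fun _ => 0) (fun _ => isC_const 1 0) continuous_const
  simpa [affineAction, vpair, Torus.div, dpair] using this

/-- The mollified current density. -/
noncomputable def mollifyCurrent (k : C(Torus d, ℝ)) (J : Current d) (u : Torus d) (i : Fin d) :
    ℝ := mollify k (pairCLM (J i)) u

theorem _root_.Torus.IsMollifier.isC_current {k : C(Torus d, ℝ)} (hk : IsMollifier k) (J : Current d)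
    (i : Fin d) (n : ℕ) : IsC n fun u => mollifyCurrent k J u i := hk.isC _ n

theorem continuous_pair_translate (μ : SignedMeasure (Torus d)) {f : Torus d → ℝ}
    (hf : Continuous f) : Continuous fun y => pair μ (fun u => f (u + y)) :=
  ((pairCLM μ).continuous.comp (continuous_translate ⟨f, hf⟩)).congr fun y =>
    pairCLM_apply μ (translate y ⟨f, hf⟩)

theorem continuous_vpair_translate (J : Current d) {F : Torus d → Fin d → ℝ}
    (hF : ∀ i, Continuous fun u => F u i) : Continuous fun y => vpair J (fun u => F (u + y)) := by
  simp only [vpair]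
  refine continuous_finsetSum _ fun i _ => ?_
  exact continuous_pair_translate (J i) (f := fun u => F u i) (hF i)

theorem _root_.Torus.IsMollifier.integral_mollifyCurrent {k : C(Torus d, ℝ)} (hk : IsMollifier k)
    (J : Current d) {F : Torus d → Fin d → ℝ} (hF : ∀ i, Continuous fun u => F u i) :
    ∑ i, ∫ u, mollifyCurrent k J u i * F u i
      = ∫ y, k y * vpair J (fun u => F (u + y)) := by
  have h1 : ∀ i, ∫ u, mollifyCurrent k J u i * F u i
      = ∫ y, k y * pair (J i) (fun u => F (u + y) i) := by
    intro i
    refine (hk.integral_mollify (pairCLM (J i)) ⟨_, hF i⟩).trans ?_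
    simp only [pairCLM_apply]
    rfl
  simp only [h1, vpair, Finset.mul_sum]
  rw [integral_finsetSum]
  intro i _
  have := continuous_pair_translate (J i) (f := fun u => F u i) (hF i)
  exact integrable_of_continuous (k.continuous.mul this)

theorem div_comp_add (F : Torus d → Fin d → ℝ) (y u : Torus d) :
    Torus.div (fun v => F (v + y)) u = Torus.div F (u + y) := by
  simp only [Torus.div]
  exact Finset.sum_congr rfl fun i _ => pderiv_comp_add (fun v => F v i) i y u

theorem integral_sub_const_mul_sub_const_mul {X : Type*} [MeasurableSpace X] {μ : Measure X}
    {a b c : X → ℝ} (ha : Integrable a μ) (hb : Integrable b μ) (hc : Integrable c μ) (s t : ℝ) :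
    ∫ x, a x - s * b x - t * c x ∂μ = ∫ x, a x ∂μ - s * (∫ x, b x ∂μ) - t * ∫ x, c x ∂μ := by
  have h : Integrable (fun x => a x - s * b x) μ := ha.sub (hb.const_mul s)
  rw [integral_sub h (hc.const_mul t), integral_sub ha (hb.const_mul s), integral_const_mul,
    integral_const_mul]

/-- The functional at the mollified pair is the `k`-average over `y` of the functional at `(J, ρ)`
with `(F, g)` translated by `y`. This uses that it is affine in `(J, ρ)`, and each term of the
average is at most `c`. -/
theorem ActionLE.mollify_le {c : ℝ} {J : Current d} {ρ : Torus d → ℝ}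
    (h : ActionLE c J ρ) (hρ : Integrable ρ)
    {k : C(Torus d, ℝ)} (hk : IsMollifier k) {F : Torus d → Fin d → ℝ} {g : Torus d → ℝ}
    (hF : ∀ i, IsC 1 fun u => F u i) (hg : Continuous g) :
    (∑ i, ∫ u, mollifyCurrent k J u i * F u i)
      - (1 / 2) * (∫ u, mollify k (densityCLM ρ hρ) u
          * (Torus.div F u + (1 - 2 * g u) * ∑ i, F u i ^ 2))
      - (1 / 2) * ∫ u, g u ^ 2 * ∑ i, F u i ^ 2 ≤ c := by
  have hFc : ∀ i, Continuous fun u => F u i := fun i => (hF i).continuous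
  have hdiv := IsC.continuous_div hF
  let G : C(Torus d, ℝ) := ⟨fun u => Torus.div F u + (1 - 2 * g u) * ∑ i, F u i ^ 2, by fun_prop⟩
  let Q : C(Torus d, ℝ) := ⟨fun u => g u ^ 2 * ∑ i, F u i ^ 2, by fun_prop⟩
  have h1 := hk.integral_mollifyCurrent J hFc
  have h2 := hk.integral_mollify (densityCLM ρ hρ) G
  have h3 : ∫ u, Q u = ∫ y, k y * ∫ u, Q (u + y) := by
    simp only [integral_add_right_eq_self]
    rw [integral_mul_const, hk.integral_eq_one, one_mul]
  have i1 : Integrable fun y => k y * vpair J (fun u => F (u + y)) := by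
    exact integrable_of_continuous (k.continuous.mul (continuous_vpair_translate J hFc))
  have i2 : Integrable fun y => k y * densityCLM ρ hρ (translate y G) :=
    integrable_of_continuous (k.continuous.mul
      ((densityCLM ρ hρ).continuous.comp (continuous_translate G)))
  have i3 : Integrable fun y => k y * ∫ u, Q (u + y) := by
    simp only [integral_add_right_eq_self]
    exact integrable_of_continuous (by fun_prop)
  have heq : ∀ y, affineAction J ρ (fun u => F (u + y)) (fun u => g (u + y))
      = vpair J (fun u => F (u + y)) - (1 / 2) * densityCLM ρ hρ (translate y G)
        - (1 / 2) * ∫ u, Q (u + y) := by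
    intro y
    simp only [affineAction, div_comp_add]
    rfl
  have hA : Integrable fun y => k y * affineAction J ρ (fun u => F (u + y)) (fun u => g (u + y)) := by
    simp only [heq, mul_sub, mul_left_comm (k _)]
    exact (i1.sub (i2.const_mul _)).sub (i3.const_mul _)
  have h4 : (∑ i, ∫ u, mollifyCurrent k J u i * F u i)
      - (1 / 2) * (∫ u, mollify k (densityCLM ρ hρ) u * G u) - (1 / 2) * ∫ u, Q u
      = ∫ y, k y * affineAction J ρ (fun u => F (u + y)) (fun u => g (u + y)) := by
    simp only [heq, mul_sub, mul_left_comm (k _)]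
    rw [h1, h2, h3, integral_sub_const_mul_sub_const_mul i1 i2 i3]
  refine (le_of_eq h4).trans ?_
  calc ∫ y, k y * affineAction J ρ (fun u => F (u + y)) (fun u => g (u + y))
      ≤ ∫ y, k y * c := by
        refine integral_mono hA (integrable_of_continuous (by fun_prop)) fun y => ?_
        exact mul_le_mul_of_nonneg_left (h _ _ (fun i => (hF i).comp_add y) (by fun_prop))
          (hk.nonneg y)
    _ = c := by rw [integral_mul_const, hk.integral_eq_one, one_mul]

theorem _root_.Torus.IsMollifier.current_pderiv {k : C(Torus d, ℝ)} (hk : IsMollifier k) {J : Current d}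
    (hJ : J ∈ divFree d) {f : Torus d → ℝ} (hf : IsC 1 f) :
    ∑ i, ∫ u, mollifyCurrent k J u i * pderiv i f u = 0 := by
  rw [hk.integral_mollifyCurrent J fun i => (IsC.pderiv (n := 0) hf i).continuous]
  have : ∀ y, vpair J (fun u i => pderiv i f (u + y)) = 0 := by
    intro y
    simpa only [pderiv_comp_add] using hJ _ (hf.comp_add y)
  simp [this]

/-- The choice `g = 1/2` replaces the mobility by its maximum `1/4` and removes `ρ` from the
quadratic term. Then `F = 4j`, with `j` the mollified current, is optimal and gives `2 ∫ |j|² ≤ c`.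
The divergence term vanishes because `j` is divergence free. The bound does not depend on the
mollifier. -/
theorem ActionLE.integral_sq_le {c : ℝ} {J : Current d} {ρ : Torus d → ℝ}
    (h : ActionLE c J ρ) (hρ : Integrable ρ)
    (hJ : J ∈ divFree d) {k : C(Torus d, ℝ)} (hk : IsMollifier k) :
    ∑ i, ∫ u, mollifyCurrent k J u i ^ 2 ≤ c / 2 := by
  have hj := fun i => hk.isC_current J i 1
  have hr := hk.isC (densityCLM ρ hρ) 1
  have hF : ∀ i, IsC 1 fun u => 4 * mollifyCurrent k J u i := fun i => (hj i).const_mul 4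
  have h1 := h.mollify_le hρ hk hF (g := fun _ => 1 / 2) continuous_const
  have h2 := hk.current_pderiv hJ hr
  have h3 := integral_mul_div hr hF
  have h4 : ∫ u, ∑ i, pderiv i (mollify k (densityCLM ρ hρ)) u
      * (4 * mollifyCurrent k J u i) = 0 := by
    rw [integral_finsetSum]
    · refine Eq.trans ?_ ((congrArg (4 * ·) h2).trans (mul_zero 4))
      simp only [Finset.mul_sum]
      refine Finset.sum_congr rfl fun i _ => ?_
      rw [← integral_const_mul]
      congr 1; ext u; ring
    · exact fun i _ => integrable_of_continuous
        ((IsC.pderiv (n := 0) hr i).continuous.mul (hF i).continuous)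
  have h5 : ∑ i, ∫ u, mollifyCurrent k J u i * (4 * mollifyCurrent k J u i)
      = 4 * ∑ i, ∫ u, mollifyCurrent k J u i ^ 2 := by
    rw [Finset.mul_sum]
    refine Finset.sum_congr rfl fun i _ => ?_
    rw [← integral_const_mul]
    congr 1; ext u; ring
  have h6 : ∫ u, (1 / 2 : ℝ) ^ 2 * ∑ i, (4 * mollifyCurrent k J u i) ^ 2
      = 4 * ∑ i, ∫ u, mollifyCurrent k J u i ^ 2 := by
    rw [integral_const_mul, integral_finsetSum]
    · simp only [mul_pow, integral_const_mul]
      rw [← Finset.mul_sum]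
      ring
    · exact fun i _ => integrable_of_continuous ((hF i).continuous.pow 2)
  norm_num only [mul_one, sub_self, zero_mul, add_zero] at h1
  norm_num only at h6
  rw [h5, h3, h4, h6] at h1
  linarith

theorem sq_integral_mul_le {f g : Torus d → ℝ} (hf : Continuous f) (hg : Continuous g) :
    (∫ u, f u * g u) ^ 2 ≤ (∫ u, f u ^ 2) * ∫ u, g u ^ 2 := by
  have h := abs_real_inner_le_norm (toL2 d ⟨f, hf⟩) (toL2 d ⟨g, hg⟩)
  have h2 := pow_le_pow_left₀ (abs_nonneg _) h 2
  rw [sq_abs, mul_pow, norm_toL2_sq, norm_toL2_sq, toL2_eq ⟨f, hf⟩, inner_toLp_toL2] at h2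
  exact h2

/-- A divergence free current of finite action has a square integrable density. -/
theorem ActionLE.exists_density {c : ℝ} {J : Current d} {ρ : Torus d → ℝ}
    (h : ActionLE c J ρ) (hρ : Integrable ρ)
    (hJ : J ∈ divFree d) :
    ∃ j : Torus d → Fin d → ℝ, (∀ i, MemLp (fun u => j u i) 2) ∧ HasDensity J j := by
  have key : ∀ i, ∃ w : Torus d → ℝ, MemLp w 2 ∧ ∀ F : C(Torus d, ℝ),
      pairCLM (J i) F = ∫ u, w u * F u := by
    intro i
    refine exists_density_of_bound (pairCLM (J i)).toLinearMap (C := c / 2) fun F => ?_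
    have hc : Continuous fun y => pairCLM (J i) (translate y F) :=
      (pairCLM (J i)).continuous.comp (continuous_translate F)
    -- The pairing of `J i` with `F` is the limit of the pairings of its mollified densities, which
    -- are bounded uniformly in `L²`.
    have h1 := (tendsto_integral_powerMollifier hc).pow 2
    rw [translate_zero] at h1
    refine le_of_tendsto h1 (Eventually.of_forall fun n => ?_)
    have hk := isMollifier_powerMollifier (d := d) n
    simp only [smul_eq_mul]
    rw [← hk.integral_mollify]
    refine (sq_integral_mul_le (hk.isC _ 0).continuous F.continuous).trans ?_
    refine mul_le_mul_of_nonneg_right ?_ (integral_nonneg fun u => sq_nonneg _)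
    refine le_trans ?_ (h.integral_sq_le hρ hJ hk)
    exact Finset.single_le_sum (f := fun i => ∫ u, mollifyCurrent (powerMollifier d n) J u i ^ 2)
      (fun i _ => integral_nonneg fun u => sq_nonneg _) (Finset.mem_univ i)
  choose w hw hJw using key
  have hi : ∀ i, Integrable (w i) := fun i => (hw i).integrable (by norm_num)
  refine ⟨fun u i => w i u, hw, fun i => ⟨hi i, signedMeasure_ext fun F => ?_⟩⟩
  rw [pair_withDensity (hi i) F.continuous, ← hJw i F, pairCLM_apply]

end MeanCurrent

namespace MeanCurrent
open Torus

variable {d : ℕ}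

/-! ### From the affine functionals to the static cost -/

theorem chi_pos {a : ℝ} (h : 0 < a ∧ a < 1) : 0 < chi a := mul_pos h.1 (by linarith [h.2])

theorem chi_le (a b : ℝ) : chi a ≤ (1 - 2 * b) * a + b ^ 2 := by
  unfold chi; nlinarith [sq_nonneg (a - b)]

/-- This is concavity of `χ` with the nonnegative term `(1 - s) χ(a)` dropped. It bounds from below
the mobility of a profile mixed with a constant. -/
theorem chi_mix {a b s : ℝ} (ha : 0 ≤ a ∧ a ≤ 1) (hs : 0 ≤ s ∧ s ≤ 1) :
    s * chi b ≤ chi ((1 - s) * a + s * b) := by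
  have h : chi ((1 - s) * a + s * b)
      = (1 - s) * chi a + s * chi b + s * (1 - s) * (a - b) ^ 2 := by
    unfold chi; ring
  have h1 : 0 ≤ (1 - s) * chi a :=
    mul_nonneg (by linarith [hs.2]) (mul_nonneg ha.1 (by linarith [ha.2]))
  have h2 : 0 ≤ s * (1 - s) * (a - b) ^ 2 :=
    mul_nonneg (mul_nonneg hs.1 (by linarith [hs.2])) (sq_nonneg _)
  linarith

/-- The field `j + ½ ∇ρ`. -/
noncomputable def drift (ρ : Torus d → ℝ) (j : Torus d → Fin d → ℝ) (u : Torus d) (i : Fin d) :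
    ℝ := j u i + (1 / 2) * pderiv i ρ u

theorem isC_drift {n : ℕ} {ρ : Torus d → ℝ} {j : Torus d → Fin d → ℝ} (hρ : IsC (n + 1) ρ)
    (hj : ∀ i, IsC n fun u => j u i) (i : Fin d) : IsC n fun u => drift ρ j u i :=
  (hj i).add ((hρ.pderiv i).const_mul _)

theorem _root_.Torus.IsC.chi {n : ℕ} {ρ : Torus d → ℝ} (hρ : IsC n ρ) : IsC n fun u => MeanCurrent.chi (ρ u) :=
  hρ.mul ((isC_const n 1).sub hρ)

/-- For a smooth current and a smooth profile the supremum of the affine functionals is attained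
at `F = (j + ½ ∇ρ) / χ(ρ)` and `g = ρ`. -/
theorem integral_drift_le {c : ℝ} {ρ : Torus d → ℝ} {j : Torus d → Fin d → ℝ} (hρ : IsC 2 ρ)
    (h01 : ∀ u, 0 < ρ u ∧ ρ u < 1) (hj : ∀ i, IsC 1 fun u => j u i)
    (h : ∀ F : Torus d → Fin d → ℝ, (∀ i, IsC 1 fun u => F u i) →
      (∑ i, ∫ u, j u i * F u i)
        - (1 / 2) * (∫ u, ρ u * (Torus.div F u + (1 - 2 * ρ u) * ∑ i, F u i ^ 2))
        - (1 / 2) * ∫ u, ρ u ^ 2 * ∑ i, F u i ^ 2 ≤ c) :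
    (1 / 2) * ∫ u, (∑ i, drift ρ j u i ^ 2) / chi (ρ u) ≤ c := by
  have hρ1 := hρ.of_le (m := 1) (by norm_num)
  have hc : ∀ u, chi (ρ u) ≠ 0 := fun u => (chi_pos (h01 u)).ne'
  have ha := isC_drift (n := 1) hρ hj
  have hF : ∀ i, IsC 1 fun u => drift ρ j u i / chi (ρ u) := fun i => (ha i).div hρ1.chi hc
  set F : Torus d → Fin d → ℝ := fun u i => drift ρ j u i / chi (ρ u) with hFdef
  have hFc : ∀ i, Continuous fun u => F u i := fun i => (hF i).continuous
  have hjc : ∀ i, Continuous fun u => j u i := fun i => (hj i).continuous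
  have hρc : Continuous ρ := hρ.continuous
  have hpc : ∀ i, Continuous fun u => pderiv i ρ u :=
    fun i => (IsC.pderiv (n := 0) hρ1 i).continuous
  have hdiv := IsC.continuous_div hF
  have hIBP := integral_mul_div hρ1 hF
  have e1 : ∫ u, ρ u * (Torus.div F u + (1 - 2 * ρ u) * ∑ i, F u i ^ 2)
      = ∫ u, (-(∑ i, pderiv i ρ u * F u i) + ρ u * (1 - 2 * ρ u) * ∑ i, F u i ^ 2) := by
    rw [integral_add (integrable_of_continuous (by fun_prop))
      (integrable_of_continuous (by fun_prop)), integral_neg, ← hIBP,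
      ← integral_add (integrable_of_continuous (by fun_prop))
      (integrable_of_continuous (by fun_prop))]
    congr 1; ext u; ring
  have e2 : ∑ i, ∫ u, j u i * F u i = ∫ u, ∑ i, j u i * F u i :=
    (integral_finsetSum _ fun i _ => integrable_of_continuous ((hjc i).mul (hFc i))).symm
  have hF' := h F hF
  rw [e1, e2, ← integral_sub_const_mul_sub_const_mul] at hF'
  rotate_left
  · exact integrable_of_continuous (by fun_prop)
  · exact integrable_of_continuous (by fun_prop)
  · exact integrable_of_continuous (by fun_prop)
  refine le_trans (le_of_eq ?_) hF'
  rw [← integral_const_mul]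
  refine integral_congr_ae (ae_of_all _ fun u => ?_)
  -- Write `X = |F|²`. The terms linear in `F` add up to `χ(ρ) X`. The quadratic terms give `½ χ(ρ)
  -- X`, since `(1 - 2ρ)ρ + ρ² = χ(ρ)`.
  have h1 : ∑ i, F u i ^ 2 = (∑ i, drift ρ j u i ^ 2) / chi (ρ u) ^ 2 := by
    simp only [hFdef, div_pow, Finset.sum_div]
  have h2 : (∑ i, j u i * F u i) + (1 / 2) * ∑ i, pderiv i ρ u * F u i
      = (∑ i, drift ρ j u i ^ 2) / chi (ρ u) := by
    rw [Finset.mul_sum, ← Finset.sum_add_distrib, Finset.sum_div]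
    refine Finset.sum_congr rfl fun i _ => ?_
    simp only [hFdef, drift]
    ring
  have h3 : (∑ i, drift ρ j u i ^ 2) / chi (ρ u)
      = chi (ρ u) * ((∑ i, drift ρ j u i ^ 2) / chi (ρ u) ^ 2) := by
    field_simp [hc u]
  simp only
  rw [h1]
  have h4 : chi (ρ u) = ρ u * (1 - ρ u) := rfl
  rw [h3] at h2 ⊢
  set X := (∑ i, drift ρ j u i ^ 2) / chi (ρ u) ^ 2
  rw [h4] at h2 ⊢
  linarith

/-- Changing the current in the static cost. -/
theorem staticCost_le_add {ρ : Torus d → ℝ} {j j' : Torus d → Fin d → ℝ} (hρ : IsC 1 ρ)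
    {κ η : ℝ} (hκ : 0 < κ) (hη : 0 < η) (hκρ : ∀ u, κ ≤ chi (ρ u))
    (h01 : ∀ u, 0 < ρ u ∧ ρ u < 1) (hj : ∀ i, MemLp (fun u => j u i) 2)
    (hj' : ∀ i, Continuous fun u => j' u i) {c D : ℝ}
    (hc : (1 / 2) * ∫ u, (∑ i, drift ρ j' u i ^ 2) / chi (ρ u) ≤ c)
    (hD : ∑ i, ∫ u, (j u i - j' u i) ^ 2 ≤ D) :
    staticCost ρ j ≤ ENNReal.ofReal ((1 + η) * c + (1 + η⁻¹) * (D / (2 * κ))) := by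
  have ha : ∀ i, Continuous fun u => drift ρ j' u i := fun i =>
    (hj' i).add (continuous_const.mul (IsC.pderiv (n := 0) hρ i).continuous)
  have hcc : Continuous fun u => chi (ρ u) := hρ.chi.continuous
  have hA : Continuous fun u => (∑ i, drift ρ j' u i ^ 2) / chi (ρ u) :=
    (by fun_prop : Continuous fun u => ∑ i, drift ρ j' u i ^ 2).div hcc
      fun u => (chi_pos (h01 u)).ne'
  have hBi : ∀ i, Integrable fun u => (j u i - j' u i) ^ 2 := fun i =>
    ((hj i).sub (memLp_of_continuous (hj' i) 2)).integrable_sq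
  have hB : Integrable fun u => ∑ i, (j u i - j' u i) ^ 2 := integrable_finsetSum _ fun i _ => hBi i
  have hpt : ∀ u, (∑ i, drift ρ j u i ^ 2) / chi (ρ u)
      ≤ (1 + η) * ((∑ i, drift ρ j' u i ^ 2) / chi (ρ u))
        + (1 + η⁻¹) * κ⁻¹ * ∑ i, (j u i - j' u i) ^ 2 := by
    intro u
    have hpos := chi_pos (h01 u)
    have h1 : ∑ i, drift ρ j u i ^ 2
        ≤ (1 + η) * (∑ i, drift ρ j' u i ^ 2) + (1 + η⁻¹) * ∑ i, (j u i - j' u i) ^ 2 := by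
      rw [Finset.mul_sum, Finset.mul_sum, ← Finset.sum_add_distrib]
      refine Finset.sum_le_sum fun i _ => ?_
      have h2 : drift ρ j u i = drift ρ j' u i + (j u i - j' u i) := by
        simp only [drift]; ring
      rw [h2]
      set a := drift ρ j' u i
      set b := j u i - j' u i
      -- Young's inequality with parameter `η`, in the form of an exact square remainder.
      have h3 : (1 + η) * a ^ 2 + (1 + η⁻¹) * b ^ 2 - (a + b) ^ 2 = η⁻¹ * (η * a - b) ^ 2 := by
        field_simp
        ring
      have h4 : 0 ≤ η⁻¹ * (η * a - b) ^ 2 := by positivity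
      linarith
    have h5 : (1 + η⁻¹) * (∑ i, (j u i - j' u i) ^ 2) / chi (ρ u)
        ≤ (1 + η⁻¹) * κ⁻¹ * ∑ i, (j u i - j' u i) ^ 2 := by
      rw [mul_right_comm, ← div_eq_mul_inv]
      refine div_le_div_of_nonneg_left ?_ hκ (hκρ u)
      exact mul_nonneg (by positivity) (Finset.sum_nonneg fun i _ => sq_nonneg _)
    calc _ ≤ ((1 + η) * (∑ i, drift ρ j' u i ^ 2)
          + (1 + η⁻¹) * ∑ i, (j u i - j' u i) ^ 2) / chi (ρ u) := by gcongr
      _ ≤ _ := by rw [add_div, mul_div_assoc]; linarith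
  have hint : Integrable fun u => (1 + η) * ((∑ i, drift ρ j' u i ^ 2) / chi (ρ u))
        + (1 + η⁻¹) * κ⁻¹ * ∑ i, (j u i - j' u i) ^ 2 :=
    ((integrable_of_continuous hA).const_mul _).add (hB.const_mul _)
  have hnn : ∀ u, 0 ≤ (1 + η) * ((∑ i, drift ρ j' u i ^ 2) / chi (ρ u))
        + (1 + η⁻¹) * κ⁻¹ * ∑ i, (j u i - j' u i) ^ 2 := by
    intro u
    have := (chi_pos (h01 u)).le
    positivity
  calc staticCost ρ j
      ≤ 2⁻¹ * ∫⁻ u, ENNReal.ofReal ((1 + η) * ((∑ i, drift ρ j' u i ^ 2) / chi (ρ u))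
        + (1 + η⁻¹) * κ⁻¹ * ∑ i, (j u i - j' u i) ^ 2) := by
        unfold staticCost
        gcongr with u
        exact hpt u
    _ = ENNReal.ofReal ((1 / 2) * ∫ u, ((1 + η) * ((∑ i, drift ρ j' u i ^ 2) / chi (ρ u))
        + (1 + η⁻¹) * κ⁻¹ * ∑ i, (j u i - j' u i) ^ 2)) := by
        rw [ENNReal.ofReal_mul (by norm_num), ofReal_integral_eq_lintegral_ofReal hint
          (ae_of_all _ hnn), one_div, ENNReal.ofReal_inv_of_pos two_pos]
        simp
    _ ≤ _ := by
        refine ENNReal.ofReal_le_ofReal ?_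
        rw [integral_add ((integrable_of_continuous hA).const_mul _) (hB.const_mul _),
          integral_const_mul, integral_const_mul, integral_finsetSum _ fun i _ => hBi i]
        have h6 : (1 + η) * ((1 / 2) * ∫ u, (∑ i, drift ρ j' u i ^ 2) / chi (ρ u))
            ≤ (1 + η) * c := by gcongr
        have h7 : (1 + η⁻¹) * (κ⁻¹ / 2) * (∑ i, ∫ u, (j u i - j' u i) ^ 2)
            ≤ (1 + η⁻¹) * (κ⁻¹ / 2) * D := by gcongr
        have h8 : D / (2 * κ) = κ⁻¹ / 2 * D := by field_simp
        rw [h8]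
        linarith

end MeanCurrent

/-! ### Smoothing and mixing, the converse bound, and lower semicontinuity. -/

namespace MeanCurrent
open Torus

variable {d : ℕ}

theorem chi_le_affine_nonneg {a : ℝ} (ha : 0 ≤ a ∧ a ≤ 1) (b : ℝ) :
    0 ≤ (1 - 2 * b) * a + b ^ 2 :=
  (mul_nonneg ha.1 (by linarith [ha.2])).trans (chi_le a b)

/-- The affine functionals of the pair `(0, m)` are not positive. -/
theorem affine_const_nonpos {m : ℝ} (hm : 0 ≤ m ∧ m ≤ 1) {F : Torus d → Fin d → ℝ}
    {g : Torus d → ℝ} (hF : ∀ i, IsC 1 fun u => F u i) (hg : Continuous g) :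
    - (1 / 2) * (∫ u, m * (Torus.div F u + (1 - 2 * g u) * ∑ i, F u i ^ 2))
      - (1 / 2) * (∫ u, g u ^ 2 * ∑ i, F u i ^ 2) ≤ 0 := by
  have hFc : ∀ i, Continuous fun u => F u i := fun i => (hF i).continuous
  have hdiv := IsC.continuous_div hF
  have h1 : ∫ u, m * Torus.div F u = 0 := by
    rw [integral_mul_div (isC_const 1 m) hF]
    simp
  have h2 : ∫ u, m * (Torus.div F u + (1 - 2 * g u) * ∑ i, F u i ^ 2)
      = ∫ u, m * ((1 - 2 * g u) * ∑ i, F u i ^ 2) := by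
    simp only [mul_add]
    rw [integral_add (integrable_of_continuous (by fun_prop))
      (integrable_of_continuous (by fun_prop)), h1, zero_add]
  have h3 : 0 ≤ ∫ u, (m * ((1 - 2 * g u) * ∑ i, F u i ^ 2) + g u ^ 2 * ∑ i, F u i ^ 2) := by
    refine integral_nonneg fun u => ?_
    have := mul_nonneg (chi_le_affine_nonneg hm (g u))
      (Finset.sum_nonneg fun i (_ : i ∈ Finset.univ) => sq_nonneg (F u i))
    simp only [Pi.zero_apply]
    linarith
  rw [integral_add (integrable_of_continuous (by fun_prop))
      (integrable_of_continuous (by fun_prop))] at h3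
  rw [h2]
  linarith

/-- The mixture of a mollified pair with `(0, m)` satisfies the same bounds. -/
theorem ActionLE.mix_le {c : ℝ} {J : Current d} {ρ : Torus d → ℝ} (h : ActionLE c J ρ)
    (hρ : Integrable ρ) {k : C(Torus d, ℝ)} (hk : IsMollifier k) {m s : ℝ} (hm : 0 ≤ m ∧ m ≤ 1)
    (hs : 0 ≤ s ∧ s ≤ 1) {F : Torus d → Fin d → ℝ} {g : Torus d → ℝ}
    (hF : ∀ i, IsC 1 fun u => F u i) (hg : Continuous g) :
    (∑ i, ∫ u, (1 - s) * mollifyCurrent k J u i * F u i)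
      - (1 / 2) * (∫ u, ((1 - s) * mollify k (densityCLM ρ hρ) u + s * m)
          * (Torus.div F u + (1 - 2 * g u) * ∑ i, F u i ^ 2))
      - (1 / 2) * ∫ u, g u ^ 2 * ∑ i, F u i ^ 2 ≤ c := by
  have hFc : ∀ i, Continuous fun u => F u i := fun i => (hF i).continuous
  have hdiv := IsC.continuous_div hF
  have hr : Continuous (mollify k (densityCLM ρ hρ)) := (hk.isC _ 0).continuous
  have h1 := h.mollify_le hρ hk hF hg
  have h2 := affine_const_nonpos hm hF hg
  have e1 : ∑ i, ∫ u, (1 - s) * mollifyCurrent k J u i * F u i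
      = (1 - s) * ∑ i, ∫ u, mollifyCurrent k J u i * F u i := by
    simp only [mul_assoc, integral_const_mul, Finset.mul_sum]
  have e2 : ∫ u, ((1 - s) * mollify k (densityCLM ρ hρ) u + s * m)
          * (Torus.div F u + (1 - 2 * g u) * ∑ i, F u i ^ 2)
      = (1 - s) * (∫ u, mollify k (densityCLM ρ hρ) u
          * (Torus.div F u + (1 - 2 * g u) * ∑ i, F u i ^ 2))
        + s * ∫ u, m * (Torus.div F u + (1 - 2 * g u) * ∑ i, F u i ^ 2) := by
    rw [← integral_const_mul, ← integral_const_mul, ← integral_add]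
    · congr 1; ext u; ring
    all_goals exact integrable_of_continuous (by fun_prop)
  rw [e1, e2]
  have h3 := mul_le_mul_of_nonneg_left h1 (sub_nonneg.2 hs.2)
  have h4 := mul_nonpos_of_nonneg_of_nonpos hs.1 h2
  have h5 := mul_nonneg hs.1 h.nonneg
  linarith

theorem pairCLM_eq_densityCLM {J : Current d} {j : Torus d → Fin d → ℝ} (h : HasDensity J j)
    (i : Fin d) : pairCLM (J i) = densityCLM (fun u => j u i) (h i).1 := by
  ext F
  exact (congrArg (fun μ => pair μ F) (h i).2).trans (pair_withDensity (h i).1 F.continuous)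

theorem tendsto_sum_integral_sq_sub {J : Current d} {j : Torus d → Fin d → ℝ}
    (h : HasDensity J j) (hj : ∀ i, MemLp (fun u => j u i) 2) :
    Tendsto (fun n => ∑ i, ∫ u, (mollifyCurrent (powerMollifier d n) J u i - j u i) ^ 2)
      atTop (𝓝 0) := by
  rw [← Finset.sum_const_zero (s := (Finset.univ : Finset (Fin d)))]
  refine tendsto_finsetSum _ fun i _ => ?_
  simp only [mollifyCurrent, pairCLM_eq_densityCLM h i]
  exact tendsto_integral_sq_mollify_sub (hj i) (h i).1

theorem integral_mollify_density {ρ : Torus d → ℝ} (hρ : Integrable ρ) {k : C(Torus d, ℝ)}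
    (hk : IsMollifier k) : ∫ u, mollify k (densityCLM ρ hρ) u = ∫ u, ρ u := by
  have := hk.integral_mollify (densityCLM ρ hρ) 1
  simp only [ContinuousMap.one_apply, mul_one, densityCLM_apply, translate_apply] at this
  rw [this, integral_mul_const, hk.integral_eq_one, one_mul]

/-- Three small parameters are tied to `s`: the Young parameter is `s`, the mixing weight `s²`, and
the squared `L²` error of mollification is below `s⁴`. The mobility is then at least `s² χ(m)`, so
the correction is of order `s⁻¹ · s⁴ / s² = s`. -/
theorem ActionLE.U_le_aux {c m s : ℝ} {J : Current d} {ρ : Profile d} (hm : 0 < m ∧ m < 1)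
    (hρm : ρ ∈ massProfiles d m) (hJ : J ∈ divFree d) (h : ActionLE c J ρ) (hs : 0 < s ∧ s < 1) :
    U m J ≤ ENNReal.ofReal ((1 + s) * c + (1 + s⁻¹) * (s ^ 4 * (2 + c) / (2 * (s ^ 2 * chi m)))) := by
  have hρ := ρ.integrable
  obtain ⟨j, hj2, hJj⟩ := h.exists_density hρ hJ
  have hlam : 0 < s ^ 2 ∧ s ^ 2 < 1 :=
    ⟨pow_pos hs.1 2, pow_lt_one₀ hs.1.le hs.2 two_ne_zero⟩
  set lam := s ^ 2 with hlam_def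
  obtain ⟨n, hn⟩ := ((tendsto_sum_integral_sq_sub hJj hj2).eventually
    (gt_mem_nhds (pow_pos hlam.1 2))).exists
  set k := powerMollifier d n
  have hk : IsMollifier k := isMollifier_powerMollifier n
  have hr01 := hk.mollify_density_mem hρ ρ.2.2
  have hrC := hk.isC (densityCLM ρ hρ) 2
  set r := mollify k (densityCLM ρ hρ)
  set j' : Torus d → Fin d → ℝ := fun u i => (1 - lam) * mollifyCurrent k J u i
  set ρ' : Torus d → ℝ := fun u => (1 - lam) * r u + lam * m
  have hρ' : IsC 2 ρ' := (hrC.const_mul _).add (isC_const 2 _)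
  have hj' : ∀ i, IsC 1 fun u => j' u i := fun i => (hk.isC_current J i 1).const_mul _
  have h01 : ∀ u, 0 < ρ' u ∧ ρ' u < 1 := by
    intro u
    have h1 := hr01 u
    simp only [ρ']
    constructor <;> nlinarith [mul_pos hlam.1 hm.1, mul_pos hlam.1 (sub_pos.2 hm.2),
      mul_nonneg (sub_pos.2 hlam.2).le h1.1, mul_nonneg (sub_pos.2 hlam.2).le (sub_nonneg.2 h1.2)]
  have hchi : ∀ u, lam * chi m ≤ chi (ρ' u) := fun u =>
    chi_mix (hr01 u) ⟨hlam.1.le, hlam.2.le⟩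
  have hcost := integral_drift_le (c := c) hρ' h01 hj' fun F hF =>
    h.mix_le hρ hk ⟨hm.1.le, hm.2.le⟩ ⟨hlam.1.le, hlam.2.le⟩ hF hρ'.continuous
  have hmass : ∫ u, ρ' u = m := by
    simp only [ρ']
    rw [integral_add (integrable_of_continuous (hrC.continuous.const_mul _))
      (integrable_const _), integral_const_mul]
    simp only [r]
    rw [integral_mollify_density hρ hk, show ∫ u, ρ u = m from hρm]
    simp only [integral_const, probReal_univ, one_smul]
    ring
  have hD : ∑ i, ∫ u, (j u i - j' u i) ^ 2 ≤ lam ^ 2 * (2 + c) := by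
    have hk2 : ∀ i, Integrable fun u => mollifyCurrent k J u i ^ 2 := fun i =>
      integrable_of_continuous ((hk.isC_current J i 0).continuous.pow 2)
    have hd2 : ∀ i, Integrable fun u => (mollifyCurrent k J u i - j u i) ^ 2 := fun i =>
      ((memLp_of_continuous (hk.isC_current J i 0).continuous 2).sub (hj2 i)).integrable_sq
    -- The error is split into the mollification error and the mass `lam` taken from the mollified
    -- current by mixing. The first is controlled by the choice of `n`, the second by
    -- `ActionLE.integral_sq_le`.
    have h1 : ∀ i, ∫ u, (j u i - j' u i) ^ 2 ≤ 2 * (∫ u, (mollifyCurrent k J u i - j u i) ^ 2)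
        + 2 * lam ^ 2 * ∫ u, mollifyCurrent k J u i ^ 2 := by
      intro i
      rw [← integral_const_mul, ← integral_const_mul, ← integral_add ((hd2 i).const_mul _)
        ((hk2 i).const_mul _)]
      refine integral_mono_of_nonneg (ae_of_all _ fun u => sq_nonneg _)
        (((hd2 i).const_mul _).add ((hk2 i).const_mul _)) (ae_of_all _ fun u => ?_)
      simp only [j']
      nlinarith [sq_nonneg (mollifyCurrent k J u i - j u i + lam * mollifyCurrent k J u i)]
    calc _ ≤ ∑ i, (2 * (∫ u, (mollifyCurrent k J u i - j u i) ^ 2)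
        + 2 * lam ^ 2 * ∫ u, mollifyCurrent k J u i ^ 2) := Finset.sum_le_sum fun i _ => h1 i
      _ = 2 * (∑ i, ∫ u, (mollifyCurrent k J u i - j u i) ^ 2)
        + 2 * lam ^ 2 * ∑ i, ∫ u, mollifyCurrent k J u i ^ 2 := by
          rw [Finset.sum_add_distrib, ← Finset.mul_sum, ← Finset.mul_sum]
      _ ≤ 2 * lam ^ 2 + 2 * lam ^ 2 * (c / 2) := by
          have := h.integral_sq_le hρ hJ hk
          gcongr
      _ = _ := by ring
  have hfin := staticCost_le_add (hρ'.of_le (by norm_num)) (mul_pos hlam.1 (chi_pos hm)) hs.1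
    hchi h01 hj2 (fun i => (hj' i).continuous) hcost hD
  have hs4 : s ^ 4 = lam ^ 2 := by rw [hlam_def]; ring
  rw [hs4]
  refine le_trans ?_ hfin
  exact iInf₂_le_of_le j ⟨hJ, hJj⟩ (iInf₂_le_of_le
    ⟨ρ', hρ'.continuous.measurable, fun u => ⟨(h01 u).1.le, (h01 u).2.le⟩⟩
    ⟨hmass, hρ', h01⟩ le_rfl)

/-- If the affine functionals are bounded by `c` at `(J, ρ)`, then `U_m(J) ≤ c`. -/
theorem ActionLE.U_le {c m : ℝ} {J : Current d} {ρ : Profile d} (hm : 0 < m ∧ m < 1)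
    (hρm : ρ ∈ massProfiles d m) (hJ : J ∈ divFree d) (h : ActionLE c J ρ) :
    U m J ≤ ENNReal.ofReal c := by
  have hchi := chi_pos hm
  have hlim : Tendsto (fun s : ℝ => ENNReal.ofReal ((1 + s) * c
      + (s ^ 2 + s) * ((2 + c) / (2 * chi m)))) (𝓝[>] 0) (𝓝 (ENNReal.ofReal c)) := by
    have : Tendsto (fun s : ℝ => ENNReal.ofReal ((1 + s) * c
      + (s ^ 2 + s) * ((2 + c) / (2 * chi m)))) (𝓝 0)
      (𝓝 (ENNReal.ofReal ((1 + 0) * c + (0 ^ 2 + 0) * ((2 + c) / (2 * chi m))))) :=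
      (ENNReal.continuous_ofReal.comp (by fun_prop)).tendsto 0
    simpa using this.mono_left nhdsWithin_le_nhds
  refine ge_of_tendsto hlim ?_
  filter_upwards [Ioo_mem_nhdsGT (zero_lt_one (α := ℝ))] with s hs
  refine (h.U_le_aux hm hρm hJ ⟨hs.1, hs.2⟩).trans (le_of_eq ?_)
  have := hs.1.ne'
  congr 2
  field_simp

theorem HasDensity.vpair_eq {J : Current d} {j : Torus d → Fin d → ℝ} (h : HasDensity J j)
    {F : Torus d → Fin d → ℝ} (hF : ∀ i, Continuous fun u => F u i) :
    vpair J F = ∫ u, ∑ i, j u i * F u i := by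
  rw [integral_finsetSum _ fun i _ => integrable_mul_continuous (h i).1 (hF i)]
  refine Finset.sum_congr rfl fun i _ => ?_
  exact (congrArg (fun μ => pair μ fun u => F u i) (h i).2).trans
    (pair_withDensity (h i).1 (hF i))

/-- The variational functional with a fixed field is bounded by the static cost. -/
theorem HasDensity.pairing_le {c : ℝ} {J : Current d} {ρ : Torus d → ℝ}
    {j : Torus d → Fin d → ℝ} (hJ : HasDensity J j) (hc : 0 ≤ c) (hρ : IsC 1 ρ)
    (h01 : ∀ u, 0 < ρ u ∧ ρ u < 1) (h : staticCost ρ j ≤ ENNReal.ofReal c)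
    {F : Torus d → Fin d → ℝ} (hF : ∀ i, IsC 1 fun u => F u i) :
    vpair J F - (1 / 2) * dpair ρ (Torus.div F)
      - (1 / 2) * dpair (fun u => chi (ρ u)) (fun u => ∑ i, F u i ^ 2) ≤ c := by
  have hFc : ∀ i, Continuous fun u => F u i := fun i => (hF i).continuous
  have hpc : ∀ i, Continuous fun u => pderiv i ρ u :=
    fun i => (IsC.pderiv (n := 0) hρ i).continuous
  have hcc : Continuous fun u => chi (ρ u) := hρ.chi.continuous
  have hm : AEStronglyMeasurable (fun u => (∑ i, drift ρ j u i ^ 2) / chi (ρ u)) := by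
    have h1 : ∀ i, AEMeasurable (fun u => drift ρ j u i) := fun i =>
      (hJ i).1.1.aemeasurable.add ((hpc i).aemeasurable.const_mul _)
    have h2 : AEMeasurable (fun u => ∑ i, drift ρ j u i ^ 2) :=
      Finset.aemeasurable_fun_sum _ fun i _ => (h1 i).pow_const 2
    exact (h2.div hcc.aemeasurable).aestronglyMeasurable
  have hnn : ∀ u, 0 ≤ (∑ i, drift ρ j u i ^ 2) / chi (ρ u) := fun u =>
    div_nonneg (Finset.sum_nonneg fun i _ => sq_nonneg _) (chi_pos (h01 u)).le
  have hL : ∫⁻ u, ENNReal.ofReal ((∑ i, drift ρ j u i ^ 2) / chi (ρ u))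
      ≤ ENNReal.ofReal (2 * c) := by
    have h1 := mul_le_mul_right h (2 : ℝ≥0∞)
    unfold staticCost at h1
    rw [← mul_assoc, ENNReal.mul_inv_cancel two_ne_zero ENNReal.ofNat_ne_top, one_mul] at h1
    rw [ENNReal.ofReal_mul two_pos.le, ENNReal.ofReal_ofNat]
    exact h1
  have hi : Integrable fun u => (∑ i, drift ρ j u i ^ 2) / chi (ρ u) :=
    (lintegral_ofReal_ne_top_iff_integrable hm (ae_of_all _ hnn)).1
      (hL.trans_lt ENNReal.ofReal_lt_top).ne
  have hle : ∫ u, (∑ i, drift ρ j u i ^ 2) / chi (ρ u) ≤ 2 * c := by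
    rw [integral_eq_lintegral_of_nonneg_ae (ae_of_all _ hnn) hm]
    exact ENNReal.toReal_le_of_le_ofReal (by linarith) hL
  have i1 : Integrable fun u => ∑ i, j u i * F u i :=
    integrable_finsetSum _ fun i _ => integrable_mul_continuous (hJ i).1 (hFc i)
  have i2 : Integrable fun u => ∑ i, pderiv i ρ u * F u i :=
    integrable_of_continuous (by fun_prop)
  have i3 : Integrable fun u => chi (ρ u) * ∑ i, F u i ^ 2 :=
    integrable_of_continuous (by fun_prop)
  have e : vpair J F - (1 / 2) * dpair ρ (Torus.div F)
      - (1 / 2) * dpair (fun u => chi (ρ u)) (fun u => ∑ i, F u i ^ 2)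
      = ∫ u, ((∑ i, j u i * F u i) - (-(1 / 2)) * (∑ i, pderiv i ρ u * F u i)
        - (1 / 2) * (chi (ρ u) * ∑ i, F u i ^ 2)) := by
    rw [integral_sub_const_mul_sub_const_mul i1 i2 i3, hJ.vpair_eq hFc, dpair, dpair,
      integral_mul_div hρ hF]
    ring
  rw [e]
  calc _ ≤ ∫ u, (1 / 2) * ((∑ i, drift ρ j u i ^ 2) / chi (ρ u)) := by
        refine integral_mono ((i1.sub (i2.const_mul _)).sub (i3.const_mul _)) (hi.const_mul _)
          fun u => ?_
        have hpos := chi_pos (h01 u)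
        have h1 : (∑ i, j u i * F u i) - (-(1 / 2)) * (∑ i, pderiv i ρ u * F u i)
            = ∑ i, drift ρ j u i * F u i := by
          rw [Finset.mul_sum, ← Finset.sum_sub_distrib]
          refine Finset.sum_congr rfl fun i _ => ?_
          simp only [drift]; ring
        simp only
        rw [h1, Finset.sum_div, Finset.mul_sum, Finset.mul_sum, Finset.mul_sum,
          ← Finset.sum_sub_distrib]
        refine Finset.sum_le_sum fun i _ => ?_
        -- Completing the square in `F` gives the pointwise Legendre inequality.
        have h2 : (1 / 2) * (drift ρ j u i ^ 2 / chi (ρ u))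
            - (drift ρ j u i * F u i - 1 / 2 * (chi (ρ u) * F u i ^ 2))
            = (1 / 2) * (drift ρ j u i - chi (ρ u) * F u i) ^ 2 / chi (ρ u) := by
          field_simp
          ring
        have h3 : 0 ≤ (1 / 2) * (drift ρ j u i - chi (ρ u) * F u i) ^ 2 / chi (ρ u) := by
          positivity
        linarith
    _ ≤ c := by rw [integral_const_mul]; linarith

/-- The affine functionals are bounded by the static cost. -/
theorem actionLE_of_staticCost_le {c : ℝ} {J : Current d} {ρ : Torus d → ℝ}
    {j : Torus d → Fin d → ℝ} (hc : 0 ≤ c) (hJ : HasDensity J j) (hρ : IsC 1 ρ)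
    (h01 : ∀ u, 0 < ρ u ∧ ρ u < 1) (h : staticCost ρ j ≤ ENNReal.ofReal c) : ActionLE c J ρ := by
  intro F g hF hg
  refine le_trans ?_ (hJ.pairing_le hc hρ h01 h hF)
  have hFc : ∀ i, Continuous fun u => F u i := fun i => (hF i).continuous
  have hdiv := IsC.continuous_div hF
  have hρc : Continuous ρ := hρ.continuous
  have hcc : Continuous fun u => chi (ρ u) := hρ.chi.continuous
  have h1 : dpair ρ (Torus.div F) + dpair (fun u => chi (ρ u)) (fun u => ∑ i, F u i ^ 2)
      ≤ dpair ρ (fun u => Torus.div F u + (1 - 2 * g u) * ∑ i, F u i ^ 2)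
        + ∫ u, g u ^ 2 * ∑ i, F u i ^ 2 := by
    simp only [dpair]
    rw [← integral_add (integrable_of_continuous (by fun_prop))
      (integrable_of_continuous (by fun_prop)),
      ← integral_add (integrable_of_continuous (by fun_prop))
      (integrable_of_continuous (by fun_prop))]
    refine integral_mono (integrable_of_continuous (by fun_prop))
      (integrable_of_continuous (by fun_prop)) fun u => ?_
    have := mul_le_mul_of_nonneg_right (chi_le (ρ u) (g u))
      (Finset.sum_nonneg fun i (_ : i ∈ Finset.univ) => sq_nonneg (F u i))
    simp only
    linarith
  unfold affineAction
  linarith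

/-- The infimum over smooth profiles need not be attained, hence the slack `1 / (n + 1)`. A near
minimizer gives one direction; `ActionLE.U_le`, valid for all measurable profiles, gives the other.
-/
theorem U_le_iff {c m : ℝ} (hc : 0 ≤ c) (hm : 0 < m ∧ m < 1) (J : Current d) :
    U m J ≤ ENNReal.ofReal c ↔
      ∀ n : ℕ, J ∈ Prod.fst '' {p : Current d × Profile d | p.2 ∈ massProfiles d m ∧
        p.1 ∈ divFree d ∧ ActionLE (c + 1 / (n + 1)) p.1 p.2} := by
  constructor
  · intro h n
    have hn : (0 : ℝ) < 1 / (n + 1) := by positivity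
    have h1 : U m J < ENNReal.ofReal (c + 1 / (n + 1)) :=
      h.trans_lt ((ENNReal.ofReal_lt_ofReal_iff (by linarith)).2 (by linarith))
    simp only [U, iInf_lt_iff] at h1
    obtain ⟨j, ⟨hJ, hj⟩, ρ, ⟨hρm, hρ2, h01⟩, h2⟩ := h1
    exact ⟨(J, ρ), ⟨hρm, hJ, actionLE_of_staticCost_le (by linarith) hj (hρ2.of_le (by norm_num))
      h01 h2.le⟩, rfl⟩
  · intro h
    have hlim : Tendsto (fun n : ℕ => ENNReal.ofReal (c + 1 / ((n : ℝ) + 1))) atTop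
        (𝓝 (ENNReal.ofReal c)) := by
      have := (tendsto_one_div_add_atTop_nhds_zero_nat (𝕜 := ℝ)).const_add c
      rw [add_zero] at this
      exact (ENNReal.continuous_ofReal.tendsto c).comp this
    refine ge_of_tendsto' hlim fun n => ?_
    obtain ⟨⟨J', ρ⟩, ⟨hρm, hJ, hA⟩, rfl⟩ := h n
    exact hA.U_le hm hρm hJ

theorem isClosed_divFree : IsClosed (divFree d) := by
  simp only [divFree, Set.ofPred_forall]
  exact isClosed_iInter fun f => isClosed_iInter fun hf => isClosed_eq
    (continuous_vpair fun i => (IsC.pderiv (n := 0) hf i).continuous) continuous_const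

theorem isClosed_actionLE (c : ℝ) :
    IsClosed {p : Current d × Profile d | ActionLE c p.1 p.2} := by
  simp only [ActionLE, Set.ofPred_forall]
  refine isClosed_iInter fun F => isClosed_iInter fun g => isClosed_iInter fun hF =>
    isClosed_iInter fun hg => isClosed_le ?_ continuous_const
  have hFc : ∀ i, Continuous fun u => F u i := fun i => (hF i).continuous
  have hdiv := IsC.continuous_div hF
  have h1 := (continuous_vpair hFc).comp (continuous_fst (X := Current d) (Y := Profile d))
  have h2 := (continuous_dpair ⟨fun u => Torus.div F u + (1 - 2 * g u) * ∑ i, F u i ^ 2,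
    by fun_prop⟩).comp (continuous_snd (X := Current d) (Y := Profile d))
  exact (h1.sub (continuous_const.mul h2)).sub continuous_const

/-- The projection along a compact factor is a closed map, so the sets in `U_le_iff` are closed. -/
theorem lowerSemicontinuous_U {m : ℝ} (hm : 0 < m ∧ m < 1) :
    LowerSemicontinuous (U m : Current d → ℝ≥0∞) := by
  rw [lowerSemicontinuous_iff_isClosed_preimage]
  intro y
  rcases eq_or_ne y ⊤ with rfl | hy
  · simp
  obtain ⟨c, hc, rfl⟩ : ∃ c : ℝ, 0 ≤ c ∧ y = ENNReal.ofReal c :=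
    ⟨y.toReal, ENNReal.toReal_nonneg, (ENNReal.ofReal_toReal hy).symm⟩
  have : U m ⁻¹' Set.Iic (ENNReal.ofReal c) = ⋂ n : ℕ, Prod.fst '' {p : Current d × Profile d |
      p.2 ∈ massProfiles d m ∧ p.1 ∈ divFree d ∧ ActionLE (c + 1 / (n + 1)) p.1 p.2} := by
    ext J
    rw [Set.mem_iInter]
    exact U_le_iff hc hm J
  rw [this]
  refine isClosed_iInter fun n => isClosedMap_fst_of_compactSpace _ ?_
  exact ((isClosed_massProfiles m).preimage continuous_snd).inter
    ((isClosed_divFree.preimage continuous_fst).inter (isClosed_actionLE _))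

end MeanCurrent

namespace MeanCurrent
open Torus

variable {d : ℕ}

/-! ### The dynamical rate function is bounded below by the static cost -/

theorem vpair_smul (c : ℝ) (J : Current d) (F : Torus d → Fin d → ℝ) :
    vpair (c • J) F = c * vpair J F := by
  simp only [vpair, Finset.mul_sum]
  exact Finset.sum_congr rfl fun i _ => pair_smul_measure c (J i) _

theorem intervalIntegrable_dpair {T : ℝ} (hT : 0 ≤ T) {π : ℝ → Profile d}
    (hπ : ContinuousOn π (Set.Icc 0 T)) (F : C(Torus d, ℝ)) :
    IntervalIntegrable (fun t => dpair (π t) F) volume 0 T := by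
  refine ContinuousOn.intervalIntegrable ?_
  rw [Set.uIcc_of_le hT]
  exact (continuous_dpair F).comp_continuousOn hπ

theorem dpair_add (ρ : Profile d) (F G : C(Torus d, ℝ)) :
    dpair ρ (F + G : C(Torus d, ℝ)) = dpair ρ F + dpair ρ G :=
  (densityCLM ρ ρ.integrable).map_add F G

theorem dpair_smul (ρ : Profile d) (c : ℝ) (F : C(Torus d, ℝ)) :
    dpair ρ (c • F : C(Torus d, ℝ)) = c * dpair ρ F :=
  (densityCLM ρ ρ.integrable).map_smul c F

/-- The time average of a weakly continuous path of profiles. -/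
theorem exists_timeAverage {T : ℝ} (hT : 0 < T) {π : ℝ → Profile d}
    (hπ : ContinuousOn π (Set.Icc 0 T)) :
    ∃ ρ : Profile d, ∀ F : C(Torus d, ℝ), T * dpair ρ F = ∫ t in (0 : ℝ)..T, dpair (π t) F := by
  have hi := fun F => intervalIntegrable_dpair hT.le hπ F
  -- The average is built from the pairings, which are continuous in time; the values `π t u` need
  -- not be jointly measurable.
  obtain ⟨ρ, hρ⟩ := exists_profile
    { toFun := fun F => T⁻¹ * ∫ t in (0 : ℝ)..T, dpair (π t) F
      map_add' := fun F G => by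
        simp only [dpair_add]
        rw [intervalIntegral.integral_add (hi F) (hi G), mul_add]
      map_smul' := fun c F => by
        simp only [dpair_smul]
        rw [intervalIntegral.integral_const_mul, RingHom.id_apply, smul_eq_mul]
        ring } fun F hF => by
      simp only [LinearMap.coe_mk, AddHom.coe_mk]
      refine ⟨mul_nonneg (inv_nonneg.2 hT.le) (intervalIntegral.integral_nonneg hT.le fun t _ =>
        (dpair_bounds (π t) F hF).1), ?_⟩
      rw [inv_mul_le_iff₀ hT]
      refine (intervalIntegral.integral_mono_on hT.le (hi F) intervalIntegrable_const
        fun t _ => (dpair_bounds (π t) F hF).2).trans (le_of_eq ?_)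
      simp
  refine ⟨ρ, fun F => ?_⟩
  rw [hρ]
  simp only [LinearMap.coe_mk, AddHom.coe_mk]
  rw [mul_inv_cancel_left₀ hT.ne']

/-- The upper bound is affine in `ρ` and hence survives time averaging. The lower bound allows
integrals in time to be compared without measurability of the nonlinear term. -/
theorem dpair_chi_bounds (ρ : Profile d) {Q g : Torus d → ℝ} (hQ : Continuous Q)
    (hQ0 : ∀ u, 0 ≤ Q u) (hg : Continuous g) :
    0 ≤ dpair (fun u => chi (ρ u)) Q ∧ dpair (fun u => chi (ρ u)) Q
      ≤ dpair ρ (fun u => (1 - 2 * g u) * Q u) + ∫ u, g u ^ 2 * Q u := by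
  have hchi : ∀ u, 0 ≤ chi (ρ u) := fun u =>
    mul_nonneg (ρ.2.2 u).1 (sub_nonneg.2 (ρ.2.2 u).2)
  refine ⟨integral_nonneg fun u => mul_nonneg (hchi u) (hQ0 u), ?_⟩
  have i1 : Integrable fun u => ρ u * ((1 - 2 * g u) * Q u) :=
    integrable_mul_continuous ρ.integrable (by fun_prop)
  have i2 : Integrable fun u => g u ^ 2 * Q u := integrable_of_continuous (by fun_prop)
  rw [dpair, dpair, ← integral_add i1 i2]
  refine integral_mono_of_nonneg (ae_of_all _ fun u => mul_nonneg (hchi u) (hQ0 u)) (i1.add i2)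
    (ae_of_all _ fun u => ?_)
  have := mul_le_mul_of_nonneg_right (chi_le (ρ u) (g u)) (hQ0 u)
  simp only
  linarith

theorem isC11_const {F : Torus d → Fin d → ℝ} (hF : ∀ i, IsC 1 fun u => F u i) :
    IsC11 fun _ => F := by
  unfold IsC11
  rw [contDiff_pi]
  exact fun i => ContDiff.comp (hF i) contDiff_snd

/-- For a field constant in time the term with `∂_t F` vanishes and the boundary term is `T ⟨J, F⟩`.
Everything else depends on the path only through its average, once `χ` is replaced by a tangent
line. -/
theorem actionLE_of_dynFunctional_le {T c : ℝ} (hT : 0 < T) {W : ℝ → Current d}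
    {π : ℝ → Profile d} (hπ : ContinuousOn π (Set.Icc 0 T)) {J : Current d} (hW : W T = T • J)
    (h : ∀ F, IsC11 F → dynFunctional T W π F ≤ c) {ρ : Profile d}
    (hρ : ∀ F : C(Torus d, ℝ), T * dpair ρ F = ∫ t in (0 : ℝ)..T, dpair (π t) F) :
    ActionLE (T⁻¹ * c) J ρ := by
  intro F g hF hg
  have hFc : ∀ i, Continuous fun u => F u i := fun i => (hF i).continuous
  have hdiv := IsC.continuous_div hF
  have hQ : Continuous fun u => ∑ i, F u i ^ 2 := by fun_prop
  have hQ0 : ∀ u, 0 ≤ ∑ i, F u i ^ 2 := fun u => Finset.sum_nonneg fun i _ => sq_nonneg _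
  have h1 := h _ (isC11_const hF)
  let D : C(Torus d, ℝ) := ⟨Torus.div F, hdiv⟩
  let Q : C(Torus d, ℝ) := ⟨fun u => (1 - 2 * g u) * ∑ i, F u i ^ 2, by fun_prop⟩
  have e1 : ∫ t in (0 : ℝ)..T, dpair (π t) (Torus.div F) = T * dpair ρ D := (hρ D).symm
  have e2 : dpair ρ (fun u => Torus.div F u + (1 - 2 * g u) * ∑ i, F u i ^ 2)
      = dpair ρ D + dpair ρ Q := dpair_add ρ D Q
  have hint := intervalIntegrable_dpair hT.le hπ Q
  have e3 : ∫ t in (0 : ℝ)..T, dpair (fun u => chi (π t u)) (fun u => ∑ i, F u i ^ 2)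
      ≤ T * dpair ρ Q + T * ∫ u, g u ^ 2 * ∑ i, F u i ^ 2 := by
    have hi2 : IntervalIntegrable (fun t => dpair (π t) Q + ∫ u, g u ^ 2 * ∑ i, F u i ^ 2)
        volume 0 T := hint.add intervalIntegrable_const
    calc _ ≤ ∫ t in (0 : ℝ)..T, (dpair (π t) Q + ∫ u, g u ^ 2 * ∑ i, F u i ^ 2) := by
          rw [intervalIntegral.integral_of_le hT.le, intervalIntegral.integral_of_le hT.le]
          refine integral_mono_of_nonneg
            (ae_of_all _ fun t => (dpair_chi_bounds (π t) hQ hQ0 hg).1) ?_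
            (ae_of_all _ fun t => (dpair_chi_bounds (π t) hQ hQ0 hg).2)
          exact (intervalIntegrable_iff_integrableOn_Ioc_of_le hT.le).1 hi2
      _ = _ := by
          rw [intervalIntegral.integral_add hint intervalIntegrable_const, hρ Q]
          simp
  have e4 : ∀ t : ℝ, vpair (W t) (fun u i => deriv (fun _ : ℝ => F u i) t) = 0 := by
    intro t
    simp [vpair]
  simp only [dynFunctional, e4, intervalIntegral.integral_zero, hW, vpair_smul, e1] at h1
  rw [affineAction, e2, le_inv_mul_iff₀ hT]
  linarith

theorem U_le_PhiTilde {m : ℝ} (hm : 0 < m ∧ m < 1) {γ : Profile d} (hγ : γ ∈ massProfiles d m)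
    (J : Current d) : U m J ≤ PhiTilde γ J := by
  unfold PhiTilde
  split_ifs with hJ
  swap
  · exact le_top
  refine le_iInf₂ fun T hT => ?_
  have hT0 : ENNReal.ofReal T ≠ 0 := by simpa using hT
  rw [PhiT, ← ENNReal.mul_le_iff_le_inv hT0 ENNReal.ofReal_ne_top]
  refine le_iInf₂ fun W hW => le_iInf fun π => ?_
  unfold rate
  split_ifs with hpath
  swap
  · exact le_top
  by_cases htop : dynCost T W π = ⊤
  · rw [htop]; exact le_top
  have hcont : ContinuousOn W (Set.Icc 0 T) ∧ ContinuousOn π (Set.Icc 0 T) := by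
    by_contra hn
    exact htop (by simp only [dynCost, if_neg hn])
  have hle : ∀ F, IsC11 F → dynFunctional T W π F ≤ (dynCost T W π).toReal := by
    intro F hF
    rw [← ENNReal.ofReal_le_iff_le_toReal htop]
    simp only [dynCost, if_pos hcont]
    exact le_iSup₂ (f := fun F (_ : IsC11 F) => ENNReal.ofReal (dynFunctional T W π F)) F hF
  obtain ⟨ρ, hρ⟩ := exists_timeAverage hT hcont.2
  have hA := actionLE_of_dynFunctional_le hT hcont.2 hW.2 hle hρ
  -- Testing the continuity equation with the constant `1` shows that mass is conserved along the
  -- path, hence by the average.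
  have hmass : ρ ∈ massProfiles d m := by
    have h1 : ∀ t ∈ Set.uIcc 0 T, dpair (π t) (1 : C(Torus d, ℝ)) = m := by
      intro t ht
      rw [Set.uIcc_of_le hT.le] at ht
      have h2 := hpath.2.2.2 t ht (fun _ => 1) (isC_const 1 1)
      have h3 : dpair γ (fun _ => 1) = m := by
        simpa [dpair] using (show ∫ u, γ u = m from hγ)
      simp only [pderiv_const, vpair_zero, h3] at h2
      have h4 : dpair (π t) (1 : C(Torus d, ℝ)) = dpair (π t) (fun _ => 1) := rfl
      linarith
    have h2 := hρ 1
    rw [intervalIntegral.integral_congr h1] at h2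
    simp only [intervalIntegral.integral_const, sub_zero, smul_eq_mul] at h2
    have h3 := mul_left_cancel₀ hT.ne' h2
    show ∫ u, ρ u = m
    simpa [dpair] using h3
  have hU := hA.U_le hm hmass hJ
  calc ENNReal.ofReal T * U m J
      ≤ ENNReal.ofReal T * ENNReal.ofReal (T⁻¹ * (dynCost T W π).toReal) := by gcongr
    _ = ENNReal.ofReal (dynCost T W π).toReal := by
        rw [← ENNReal.ofReal_mul hT.le, mul_inv_cancel_left₀ hT.ne']
    _ = dynCost T W π := ENNReal.ofReal_toReal htop

/-- A lower semicontinuous minorant of `PhiTilde` lies below its envelope. -/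
theorem U_le_Phi {m : ℝ} (hm : 0 < m ∧ m < 1) {γ : Profile d} (hγ : γ ∈ massProfiles d m)
    (J : Current d) : U m J ≤ Phi γ J := by
  refine le_of_forall_lt fun a ha => ?_
  obtain ⟨b, hab, hb⟩ := exists_between ha
  have h2 := (lowerSemicontinuous_U hm) J b hb
  obtain ⟨V, hV, hVo, hJV⟩ := eventually_nhds_iff.1 h2
  refine hab.trans_le ?_
  refine le_trans ?_ (le_iSup₂ (f := fun (V : Set (Current d)) (_ : IsOpen V ∧ J ∈ V) =>
    ⨅ J' ∈ V, PhiTilde γ J') V ⟨hVo, hJV⟩)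
  exact le_iInf₂ fun J' hJ' => (hV J' hJ').le.trans (U_le_PhiTilde hm hγ J')

end MeanCurrent

/-! ### Upper bound: a connecting current, the cost of a segment, the recovery path. -/

namespace Torus

variable {d : ℕ}

/-! ### A vector field with prescribed divergence -/

/-- The representative of a point of the torus in `[0, 1)^d`. -/
noncomputable def section01 (y : Torus d) (i : Fin d) : ℝ :=
  (AddCircle.measurableEquivIco (1 : ℝ) 0 (y i) : ℝ)

theorem measurable_section01 : Measurable (section01 (d := d)) :=
  measurable_pi_lambda _ fun i => measurable_subtype_coe.comp
    ((AddCircle.measurableEquivIco (1 : ℝ) 0).measurable.comp (measurable_pi_apply i))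

theorem proj_section01 (y : Torus d) : proj (section01 y) = y := by
  ext i
  exact (AddCircle.equivIco (1 : ℝ) 0).symm_apply_apply (y i)

theorem abs_section01_le (y : Torus d) (i : Fin d) : |section01 y i| ≤ 1 := by
  have h := (AddCircle.measurableEquivIco (1 : ℝ) 0 (y i)).2
  rw [section01, abs_of_nonneg h.1]
  linarith [h.2]

/-- The uniform measure on the segments from `0` to the points of `[0, 1)^d`. -/
noncomputable def segmentMeasure (d : ℕ) : Measure (Torus d × ℝ) :=
  (volume : Measure (Torus d)).prod (volume.restrict (Set.Ioc 0 1))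

instance : IsFiniteMeasure (segmentMeasure d) := by
  unfold segmentMeasure; infer_instance

theorem measurable_segment : Measurable fun p : Torus d × ℝ => proj (p.2 • section01 p.1) :=
  continuous_proj.measurable.comp
    (measurable_snd.smul (measurable_section01.comp measurable_fst))

theorem integrable_segment (h : C(Torus d, ℝ)) (i : Fin d) :
    Integrable (fun p : Torus d × ℝ => section01 p.1 i • translate (-proj (p.2 • section01 p.1)) h)
      (segmentMeasure d) := by
  refine Integrable.of_bound ?_ ‖h‖ (ae_of_all _ fun p => ?_)
  · have h1 : Measurable fun p : Torus d × ℝ => section01 p.1 i :=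
      (measurable_pi_apply i).comp (measurable_section01.comp measurable_fst)
    have h2 : StronglyMeasurable fun p : Torus d × ℝ =>
        translate (-proj (p.2 • section01 p.1)) h :=
      (continuous_translate h).stronglyMeasurable.comp_measurable measurable_segment.neg
    exact h1.aestronglyMeasurable.smul h2.aestronglyMeasurable
  · rw [norm_smul]
    refine (mul_le_of_le_one_left (norm_nonneg _) (abs_section01_le p.1 i)).trans ?_
    exact (ContinuousMap.norm_le _ (norm_nonneg _)).2 fun u => h.norm_coe_le_norm _

/-- The field `v ↦ -∫ ∫₀¹ h(v - s y) y ds dy`, with `y` uniform in `[0, 1)^d`. -/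
noncomputable def invDiv (h : C(Torus d, ℝ)) (i : Fin d) : C(Torus d, ℝ) :=
  -∫ p, section01 p.1 i • translate (-proj (p.2 • section01 p.1)) h ∂segmentMeasure d

/-- After a translation the pairing is `-∫ h(u) y·∇f(u + s y) du`, averaged over `s` and `y`.
Integrating in `s` gives `f(u + y) - f(u)`. Averaging over `y` replaces `f(u + y)` by the mean of
`f`, which disappears because `h` has mean zero. -/
theorem integral_invDiv (h : C(Torus d, ℝ)) (h0 : ∫ u, h u = 0) {f : Torus d → ℝ} (hf : IsC 1 f) :
    ∑ i, ∫ u, invDiv h i u * pderiv i f u = ∫ u, h u * f u := by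
  have hp : ∀ i, Continuous (pderiv i f) := fun i => (IsC.pderiv (n := 0) hf i).continuous
  have hpi := fun i => integrable_of_continuous (hp i)
  have hhi := integrable_of_continuous h.continuous
  let f' : Fin d → C(Torus d, ℝ) := fun i => ⟨pderiv i f, hp i⟩
  let fc : C(Torus d, ℝ) := ⟨f, hf.continuous⟩
  have hshift : ∀ (i : Fin d) (y : Torus d), densityCLM (pderiv i f) (hpi i) (translate (-y) h)
      = densityCLM h hhi (translate y (f' i)) := by
    intro i y
    simp only [densityCLM_apply, translate_apply, f', ContinuousMap.coe_mk]
    rw [← integral_add_right_eq_self _ y]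
    congr 1; ext u; rw [add_neg_cancel_right, mul_comm]
  set ψ : Fin d → Torus d × ℝ → ℝ := fun i p =>
    section01 p.1 i * densityCLM h hhi (translate (proj (p.2 • section01 p.1)) (f' i)) with hψ
  have hψi : ∀ i, Integrable (ψ i) (segmentMeasure d) := by
    intro i
    have := (densityCLM (pderiv i f) (hpi i)).integrable_comp (integrable_segment h i)
    simpa only [map_smul, hshift, smul_eq_mul] using this
  have h1 : ∀ i, ∫ u, invDiv h i u * pderiv i f u = -∫ p, ψ i p ∂segmentMeasure d := by
    intro i
    have := (densityCLM (pderiv i f) (hpi i)).integral_comp_comm (integrable_segment h i)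
    simp only [map_smul, hshift, smul_eq_mul] at this
    rw [hψ, this, ← map_neg]
    simp only [mul_comm, densityCLM_apply]
    rfl
  have h2 : ∀ y, ∫ s in Set.Ioc (0 : ℝ) 1, ∑ i, ψ i (y, s)
      = densityCLM h hhi (translate y fc) - densityCLM h hhi fc := by
    intro y
    have hcurve : ∀ s : ℝ, HasDerivAt (fun s : ℝ => translate (proj (s • section01 y)) fc)
        (∑ i, section01 y i • translate (proj (s • section01 y)) (f' i)) s := by
      refine hasDerivAt_curve (G' := fun s => ∑ i, section01 y i •
        translate (proj (s • section01 y)) (f' i)) ?_ fun s u => ?_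
      · refine continuous_finsetSum _ fun i _ => continuous_const.fun_smul ?_
        exact (continuous_translate (f' i)).comp (continuous_proj.comp (by fun_prop))
      · simpa [ContinuousMap.sum_apply, f', fc] using hf.hasDerivAt_line u (section01 y) s
    have hder : ∀ s : ℝ, HasDerivAt
        (fun s : ℝ => densityCLM h hhi (translate (proj (s • section01 y)) fc))
        (∑ i, ψ i (y, s)) s := by
      intro s
      have := (densityCLM h hhi).hasFDerivAt.comp_hasDerivAt s (hcurve s)
      simpa [hψ, map_sum, Function.comp_def] using this
    have hcont : Continuous fun s => ∑ i, ψ i (y, s) := by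
      have hc : ∀ i, Continuous fun s : ℝ =>
          densityCLM h hhi (translate (proj (s • section01 y)) (f' i)) := fun i =>
        (densityCLM h hhi).continuous.comp
          ((continuous_translate (f' i)).comp (continuous_proj.comp (by fun_prop)))
      simp only [hψ]
      fun_prop
    rw [← intervalIntegral.integral_of_le zero_le_one,
      intervalIntegral.integral_eq_sub_of_hasDerivAt (fun s _ => hder s)
        (hcont.intervalIntegrable 0 1)]
    simp [proj_section01]
  have h3 : ∫ y, densityCLM h hhi (translate y fc) = 0 := by
    have hint := integrable_of_continuous (continuous_translate fc)
    rw [(densityCLM h hhi).integral_comp_comm hint, densityCLM_apply]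
    have : ∀ u, (∫ y, translate y fc) u = ∫ v, f v := by
      intro u
      rw [ContinuousMap.integral_apply hint]
      simp only [translate_apply, fc, ContinuousMap.coe_mk]
      exact integral_add_left_eq_self f u
    simp only [this]
    rw [integral_mul_const, h0, zero_mul]
  simp only [h1]
  rw [Finset.sum_neg_distrib, ← integral_finsetSum _ fun i _ => hψi i, segmentMeasure,
    integral_prod _ (integrable_finsetSum _ fun i _ => hψi i)]
  simp only [h2]
  have hcf : Continuous fun y => densityCLM h hhi (translate y fc) :=
    (densityCLM h hhi).continuous.comp (continuous_translate fc)
  rw [integral_sub (integrable_of_continuous hcf) (integrable_const _), h3]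
  simp [fc]

end Torus

namespace MeanCurrent
open Torus

variable {d : ℕ}

/-! ### Time dependent test fields -/

/-- The time derivative of a time dependent field. -/
noncomputable def timeDeriv (F : ℝ → Torus d → Fin d → ℝ) (t : ℝ) (u : Torus d) (i : Fin d) : ℝ :=
  deriv (fun s => F s u i) t

section

variable {F : ℝ → Torus d → Fin d → ℝ}

theorem IsC11.contDiff_apply (hF : IsC11 F) (i : Fin d) :
    ContDiff ℝ 1 (fun p : ℝ × (Fin d → ℝ) => F p.1 (proj p.2) i) :=
  contDiff_pi.1 hF i

theorem IsC11.isC (hF : IsC11 F) (t : ℝ) (i : Fin d) : IsC 1 fun u => F t u i :=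
  (hF.contDiff_apply i).comp (contDiff_const.prodMk contDiff_id)

theorem IsC11.continuous (hF : IsC11 F) (i : Fin d) :
    Continuous fun p : ℝ × Torus d => F p.1 p.2 i :=
  continuous_prod_lift_iff.2 (hF.contDiff_apply i).continuous

theorem IsC11.hasDerivAt (hF : IsC11 F) (t : ℝ) (x : Fin d → ℝ) (i : Fin d) :
    HasDerivAt (fun s => F s (proj x) i)
      (fderiv ℝ (fun p : ℝ × (Fin d → ℝ) => F p.1 (proj p.2) i) (t, x) (1, 0)) t := by
  have h1 := ((hF.contDiff_apply i).differentiable one_ne_zero (t, x)).hasFDerivAt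
  have h2 : HasDerivAt (fun s : ℝ => (s, x)) (1, 0) t :=
    (hasDerivAt_id t).prodMk (hasDerivAt_const t x)
  exact h1.comp_hasDerivAt t h2

theorem IsC11.hasDerivAt_timeDeriv (hF : IsC11 F) (t : ℝ) (u : Torus d) (i : Fin d) :
    HasDerivAt (fun s => F s u i) (timeDeriv F t u i) t := by
  obtain ⟨x, rfl⟩ := proj_surjective u
  exact (hF.hasDerivAt t x i).differentiableAt.hasDerivAt

theorem IsC11.continuous_fderiv_apply (hF : IsC11 F) (i : Fin d) (v : ℝ × (Fin d → ℝ)) :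
    Continuous fun p => fderiv ℝ (fun p : ℝ × (Fin d → ℝ) => F p.1 (proj p.2) i) p v :=
  ((hF.contDiff_apply i).continuous_fderiv one_ne_zero).clm_apply continuous_const

theorem IsC11.continuous_timeDeriv (hF : IsC11 F) (i : Fin d) :
    Continuous fun p : ℝ × Torus d => timeDeriv F p.1 p.2 i := by
  rw [continuous_prod_lift_iff]
  refine (hF.continuous_fderiv_apply i (1, 0)).congr fun p => ?_
  exact (hF.hasDerivAt p.1 p.2 i).deriv.symm

theorem IsC11.continuous_div (hF : IsC11 F) :
    Continuous fun p : ℝ × Torus d => Torus.div (F p.1) p.2 := by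
  unfold Torus.div
  refine continuous_finsetSum _ fun i _ => ?_
  rw [continuous_prod_lift_iff]
  refine (hF.continuous_fderiv_apply i (0, Pi.single i 1)).congr fun p => ?_
  rw [(hF.isC p.1 i).pderiv_proj i p.2]
  have h1 := ((hF.contDiff_apply i).differentiable one_ne_zero (p.1, p.2)).hasFDerivAt
  have h2 : HasFDerivAt (fun x : Fin d → ℝ => (p.1, x))
      (ContinuousLinearMap.inr ℝ ℝ (Fin d → ℝ)) p.2 := hasFDerivAt_prodMk_right p.1 p.2
  have h3 := (h1.comp p.2 h2).fderiv
  rw [Function.comp_def] at h3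
  rw [h3]
  rfl

/-- The curve `t ↦ F_t` in the space of continuous functions. -/
noncomputable def curve (f : ℝ → Torus d → ℝ) (hf : Continuous fun p : ℝ × Torus d => f p.1 p.2)
    (t : ℝ) : C(Torus d, ℝ) :=
  ⟨f t, hf.comp (continuous_const.prodMk continuous_id)⟩

theorem continuous_curve (f : ℝ → Torus d → ℝ)
    (hf : Continuous fun p : ℝ × Torus d => f p.1 p.2) : Continuous (curve f hf) :=
  ContinuousMap.continuous_of_continuous_uncurry _ hf

theorem continuous_vpair_curve (J : Current d) {G : ℝ → Torus d → Fin d → ℝ}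
    (hG : ∀ i, Continuous fun p : ℝ × Torus d => G p.1 p.2 i) :
    Continuous fun t => vpair J (G t) := by
  have h : ∀ i, Continuous fun t => pairCLM (J i) (curve (fun t u => G t u i) (hG i) t) := fun i =>
    (pairCLM (J i)).continuous.comp (continuous_curve _ (hG i))
  exact continuous_finsetSum Finset.univ fun i _ => h i

theorem IsC11.hasDerivAt_vpair (hF : IsC11 F) (J : Current d) (t : ℝ) :
    HasDerivAt (fun s => vpair J (F s)) (vpair J (timeDeriv F t)) t := by
  have h : ∀ i, HasDerivAt (fun s => pairCLM (J i) (curve (fun t u => F t u i) (hF.continuous i) s))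
      (pairCLM (J i) (curve (fun t u => timeDeriv F t u i) (hF.continuous_timeDeriv i) t)) t := by
    intro i
    exact (pairCLM (J i)).hasFDerivAt.comp_hasDerivAt t (hasDerivAt_curve
      (continuous_curve _ (hF.continuous_timeDeriv i))
      (fun t u => hF.hasDerivAt_timeDeriv t u i) t)
  exact HasDerivAt.fun_sum (u := Finset.univ) fun i _ => h i

theorem continuous_integral_curve {f : ℝ → Torus d → ℝ}
    (hf : Continuous fun p : ℝ × Torus d => f p.1 p.2) : Continuous fun t => ∫ u, f t u := by
  have := (densityCLM (d := d) (fun _ => 1) (integrable_const 1)).continuous.comp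
    (continuous_curve f hf)
  simpa [Function.comp_def, curve] using this

/-- Along a segment on which `W` is affine in time with slope `w`, the dynamical functional is
bounded by the static cost of the slope. -/
theorem segment_le (hF : IsC11 F) {p q c : ℝ} (hpq : p ≤ q) (hc : 0 ≤ c) {W : ℝ → Current d}
    {π : ℝ → Profile d} {X w : Current d} {j : Torus d → Fin d → ℝ} (hw : HasDensity w j)
    (hW : ∀ t ∈ Set.Icc p q, ∀ G : Torus d → Fin d → ℝ, (∀ i, Continuous fun u => G u i) →
      vpair (W t) G = vpair X G + (t - p) * vpair w G)
    (hπ : Continuous fun z : ℝ × Torus d => π z.1 z.2)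
    (hπ1 : ∀ t ∈ Set.Icc p q, IsC 1 (π t) ∧ ∀ u, 0 < π t u ∧ π t u < 1)
    (hcost : ∀ t ∈ Set.Icc p q, staticCost (π t) j ≤ ENNReal.ofReal c) :
    vpair (W q) (F q) - vpair (W p) (F p) - (∫ t in p..q, vpair (W t) (timeDeriv F t))
      - (1 / 2) * (∫ t in p..q, dpair (π t) (Torus.div (F t)))
      - (1 / 2) * (∫ t in p..q, dpair (fun u => chi (π t u)) (fun u => ∑ i, F t u i ^ 2))
      ≤ (q - p) * c := by
  have hFc : ∀ t i, Continuous fun u => F t u i := fun t i => (hF.isC t i).continuous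
  have hFd : ∀ t i, Continuous fun u => timeDeriv F t u i := fun t i =>
    (hF.continuous_timeDeriv i).comp (continuous_const.prodMk continuous_id)
  have cX' := continuous_vpair_curve X hF.continuous_timeDeriv
  have cw' := continuous_vpair_curve w hF.continuous_timeDeriv
  have cw := continuous_vpair_curve w hF.continuous
  have cS : Continuous fun t => vpair X (timeDeriv F t) + (t - p) * vpair w (timeDeriv F t) :=
    cX'.fun_add ((continuous_id.sub continuous_const).fun_mul cw')
  have hpm : p ∈ Set.Icc p q := Set.left_mem_Icc.2 hpq
  have hqm : q ∈ Set.Icc p q := Set.right_mem_Icc.2 hpq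
  have e1 : ∫ t in p..q, vpair (W t) (timeDeriv F t)
      = ∫ t in p..q, (vpair X (timeDeriv F t) + (t - p) * vpair w (timeDeriv F t)) := by
    refine intervalIntegral.integral_congr fun t ht => ?_
    rw [Set.uIcc_of_le hpq] at ht
    exact hW t ht _ (hFd t)
  -- Integration by parts in time: the boundary terms minus the term with `∂_t F` leave `∫ ⟨w, F_t⟩
  -- dt`. The static inequality `HasDensity.pairing_le` then applies at each time.
  have e2 : ∫ t in p..q, ((vpair X (timeDeriv F t) + (t - p) * vpair w (timeDeriv F t))
      + vpair w (F t)) = vpair (W q) (F q) - vpair (W p) (F p) := by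
    rw [hW q hqm _ (hFc q), hW p hpm _ (hFc p)]
    refine intervalIntegral.integral_eq_sub_of_hasDerivAt
      (f := fun t => vpair X (F t) + (t - p) * vpair w (F t)) (fun t _ => ?_)
      ((cS.add cw).intervalIntegrable _ _)
    have h1 := (hF.hasDerivAt_vpair X t).fun_add
      (((hasDerivAt_id t).sub_const p).fun_mul (hF.hasDerivAt_vpair w t))
    refine h1.congr_deriv ?_
    simp only [id]
    ring
  rw [intervalIntegral.integral_add (cS.intervalIntegrable _ _)
    (cw.intervalIntegrable _ _)] at e2
  have cdiv : Continuous fun t => dpair (π t) (Torus.div (F t)) :=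
    continuous_integral_curve (hπ.mul hF.continuous_div)
  have cchi : Continuous fun t => dpair (fun u => chi (π t u)) (fun u => ∑ i, F t u i ^ 2) := by
    refine continuous_integral_curve (f := fun t u => chi (π t u) * ∑ i, F t u i ^ 2) ?_
    have := hF.continuous
    unfold chi
    fun_prop
  have e3 : (∫ t in p..q, vpair w (F t)) - (1 / 2) * (∫ t in p..q, dpair (π t) (Torus.div (F t)))
      - (1 / 2) * (∫ t in p..q, dpair (fun u => chi (π t u)) (fun u => ∑ i, F t u i ^ 2))
      = ∫ t in p..q, (vpair w (F t) - (1 / 2) * dpair (π t) (Torus.div (F t))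
        - (1 / 2) * dpair (fun u => chi (π t u)) (fun u => ∑ i, F t u i ^ 2)) := by
    have i1 := cw.intervalIntegrable (μ := volume) p q
    have i2 := (cdiv.const_mul (1 / 2)).intervalIntegrable (μ := volume) p q
    have i3 := (cchi.const_mul (1 / 2)).intervalIntegrable (μ := volume) p q
    rw [intervalIntegral.integral_sub (i1.sub i2) i3, intervalIntegral.integral_sub i1 i2,
      intervalIntegral.integral_const_mul, intervalIntegral.integral_const_mul]
  have e4 : ∫ t in p..q, (vpair w (F t) - (1 / 2) * dpair (π t) (Torus.div (F t))
        - (1 / 2) * dpair (fun u => chi (π t u)) (fun u => ∑ i, F t u i ^ 2))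
      ≤ ∫ t in p..q, c := by
    refine intervalIntegral.integral_mono_on hpq (Continuous.intervalIntegrable
      ((cw.sub (cdiv.const_mul _)).sub (cchi.const_mul _)) _ _) intervalIntegrable_const
      fun t ht => ?_
    exact hw.pairing_le hc (hπ1 t ht).1 (hπ1 t ht).2 (hcost t ht) (hF.isC t)
  rw [intervalIntegral.integral_const, smul_eq_mul] at e4
  linarith

end

theorem isCadlagOn_of_continuous {X : Type*} [TopologicalSpace X] {x : ℝ → X} (hx : Continuous x)
    (T : ℝ) : IsCadlagOn T x :=
  ⟨fun _ _ => hx.continuousWithinAt, fun t _ => ⟨x t, hx.continuousWithinAt⟩⟩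

end MeanCurrent

namespace MeanCurrent
open Torus

variable {d : ℕ}

/-! ### The recovery path -/

/-- The weight of the target profile at time `t`: it rises from `0` to `1` on `[0, 1]` and falls
back to `0` on `[T - 1, T]`. -/
noncomputable def rampHeight (T t : ℝ) : ℝ := max 0 (min 1 (min t (T - t)))

/-- The time spent in the target profile up to time `t`. -/
noncomputable def rampTime (T t : ℝ) : ℝ := max 0 (min (t - 1) (T - 2))

theorem continuous_rampHeight (T : ℝ) : Continuous (rampHeight T) := by
  unfold rampHeight; fun_prop

theorem continuous_rampTime (T : ℝ) : Continuous (rampTime T) := by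
  unfold rampTime; fun_prop

theorem rampHeight_mem (T t : ℝ) : 0 ≤ rampHeight T t ∧ rampHeight T t ≤ 1 := by
  unfold rampHeight; simp

theorem ramp_first {T t : ℝ} (hT : 2 < T) (ht : t ∈ Set.Icc 0 1) :
    rampHeight T t = t ∧ rampTime T t = 0 := by
  obtain ⟨h0, h1⟩ := ht
  unfold rampHeight rampTime
  rw [min_eq_left (by linarith : t ≤ T - t), min_eq_right h1, max_eq_right h0,
    min_eq_left (by linarith), max_eq_left (by linarith)]
  exact ⟨rfl, rfl⟩

theorem ramp_middle {T t : ℝ} (ht : t ∈ Set.Icc 1 (T - 1)) :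
    rampHeight T t = 1 ∧ rampTime T t = t - 1 := by
  obtain ⟨h0, h1⟩ := ht
  unfold rampHeight rampTime
  rw [min_eq_left (le_min h0 (by linarith)), max_eq_right zero_le_one,
    min_eq_left (by linarith), max_eq_right (by linarith)]
  exact ⟨rfl, rfl⟩

theorem ramp_last {T t : ℝ} (hT : 2 < T) (ht : t ∈ Set.Icc (T - 1) T) :
    rampHeight T t = T - t ∧ rampTime T t = T - 2 := by
  obtain ⟨h0, h1⟩ := ht
  unfold rampHeight rampTime
  rw [min_eq_right (by linarith : T - t ≤ t), min_eq_right (by linarith),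
    max_eq_right (by linarith), min_eq_right (by linarith), max_eq_right (by linarith)]
  exact ⟨rfl, rfl⟩

/-- The path of profiles from `γ` to `ρ` and back. -/
noncomputable def rampProfile (γ ρ : Profile d) (T t : ℝ) : Profile d :=
  ⟨fun u => (1 - rampHeight T t) * γ u + rampHeight T t * ρ u,
    (γ.2.1.const_mul _).add (ρ.2.1.const_mul _), fun u => by
      have h := rampHeight_mem T t
      have h1 := γ.2.2 u
      have h2 := ρ.2.2 u
      have h3 : 0 ≤ 1 - rampHeight T t := by linarith
      constructor <;> nlinarith [mul_nonneg h3 h1.1, mul_nonneg h.1 h2.1,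
        mul_nonneg h3 (sub_nonneg.2 h1.2), mul_nonneg h.1 (sub_nonneg.2 h2.2)]⟩

theorem rampProfile_apply (γ ρ : Profile d) (T t : ℝ) (u : Torus d) :
    rampProfile γ ρ T t u = (1 - rampHeight T t) * γ u + rampHeight T t * ρ u := rfl

/-- The path of integrated currents. -/
noncomputable def rampCurrent (K J : Current d) (T t : ℝ) : Current d :=
  rampHeight T t • K + rampTime T t • J

theorem pair_rampCurrent (K J : Current d) (T t : ℝ) (i : Fin d) {f : Torus d → ℝ}
    (hf : Continuous f) :
    pair (rampCurrent K J T t i) f = rampHeight T t * pair (K i) f + rampTime T t * pair (J i) f :=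
  (pair_add_measure _ _ hf).trans (by rw [Pi.smul_apply, Pi.smul_apply, pair_smul_measure,
    pair_smul_measure])

theorem vpair_rampCurrent (K J : Current d) (T t : ℝ) {G : Torus d → Fin d → ℝ}
    (hG : ∀ i, Continuous fun u => G u i) :
    vpair (rampCurrent K J T t) G = rampHeight T t * vpair K G + rampTime T t * vpair J G := by
  simp only [vpair, Finset.mul_sum]
  rw [← Finset.sum_add_distrib]
  exact Finset.sum_congr rfl fun i _ => pair_rampCurrent K J T t i (hG i)

theorem continuous_rampCurrent (K J : Current d) (T : ℝ) : Continuous (rampCurrent K J T) := by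
  rw [continuous_current_iff]
  intro i F
  simp only [pair_rampCurrent K J T _ i F.continuous]
  exact ((continuous_rampHeight T).mul continuous_const).add
    ((continuous_rampTime T).mul continuous_const)

theorem dpair_rampProfile (γ ρ : Profile d) (T t : ℝ) {f : Torus d → ℝ} (hf : Continuous f) :
    dpair (rampProfile γ ρ T t) f
      = dpair γ f + rampHeight T t * ∫ u, (ρ u - γ u) * f u := by
  have hd : Integrable fun u => ρ u - γ u := ρ.integrable.sub γ.integrable
  rw [← integral_const_mul, dpair, dpair, ← integral_add
    (integrable_mul_continuous γ.integrable hf) ((integrable_mul_continuous hd hf).const_mul _)]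
  congr 1
  ext u
  rw [rampProfile_apply]
  ring

theorem continuous_rampProfile (γ ρ : Profile d) (T : ℝ) : Continuous (rampProfile γ ρ T) := by
  rw [continuous_profile_iff]
  intro F
  simp only [dpair_rampProfile γ ρ T _ F.continuous]
  exact continuous_const.add ((continuous_rampHeight T).mul continuous_const)

theorem isC_rampProfile {n : ℕ} {γ ρ : Profile d} (hγ : IsC n γ) (hρ : IsC n ρ) (T t : ℝ) :
    IsC n (rampProfile γ ρ T t) := (hγ.const_mul _).add (hρ.const_mul _)

theorem rampProfile_pos {γ ρ : Profile d} (hγ : ∀ u, 0 < γ u ∧ γ u < 1)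
    (hρ : ∀ u, 0 < ρ u ∧ ρ u < 1) (T t : ℝ) (u : Torus d) :
    0 < rampProfile γ ρ T t u ∧ rampProfile γ ρ T t u < 1 := by
  rw [rampProfile_apply]
  obtain ⟨h0, h1⟩ := rampHeight_mem T t
  set a := rampHeight T t
  have h2 := hγ u
  have h3 := hρ u
  have := convex_Ioo (0 : ℝ) 1 (x := γ u) ⟨h2.1, h2.2⟩ (y := ρ u) ⟨h3.1, h3.2⟩
    (sub_nonneg.2 h1) h0 (by ring)
  simpa using this

theorem exists_pos_le_chi {ρ : Torus d → ℝ} (hρ : Continuous ρ) (h01 : ∀ u, 0 < ρ u ∧ ρ u < 1) :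
    ∃ κ : ℝ, 0 < κ ∧ ∀ u, κ ≤ chi (ρ u) := by
  have hc : Continuous fun u => chi (ρ u) := by unfold chi; fun_prop
  obtain ⟨u, -, hu⟩ := isCompact_univ.exists_isMinOn Set.univ_nonempty hc.continuousOn
  exact ⟨chi (ρ u), chi_pos (h01 u), fun v => hu (Set.mem_univ v)⟩

theorem chi_convex_comb {a b s κ : ℝ} (hs : 0 ≤ s ∧ s ≤ 1) (ha : κ ≤ chi a) (hb : κ ≤ chi b) :
    κ ≤ chi ((1 - s) * a + s * b) := by
  have h : chi ((1 - s) * a + s * b)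
      = (1 - s) * chi a + s * chi b + s * (1 - s) * (a - b) ^ 2 := by
    unfold chi; ring
  have h1 := mul_le_mul_of_nonneg_left ha (sub_nonneg.2 hs.2)
  have h2 := mul_le_mul_of_nonneg_left hb hs.1
  have h3 : 0 ≤ s * (1 - s) * (a - b) ^ 2 :=
    mul_nonneg (mul_nonneg hs.1 (sub_nonneg.2 hs.2)) (sq_nonneg _)
  linarith

theorem staticCost_le_of_bound {ρ : Torus d → ℝ} {j : Torus d → Fin d → ℝ} {M κ : ℝ} (hκ : 0 < κ)
    (hM : ∀ u i, |drift ρ j u i| ≤ M) (hchi : ∀ u, κ ≤ chi (ρ u)) :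
    staticCost ρ j ≤ ENNReal.ofReal (d * M ^ 2 / κ) := by
  have h1 : ∀ u, (∑ i, drift ρ j u i ^ 2) / chi (ρ u) ≤ d * M ^ 2 / κ := by
    intro u
    refine div_le_div₀ (by positivity) ?_ hκ (hchi u)
    refine (Finset.sum_le_sum fun i _ => ?_).trans (le_of_eq ?_) (b := ∑ _i : Fin d, M ^ 2)
    · rw [← sq_abs]
      exact pow_le_pow_left₀ (abs_nonneg _) (hM u i) 2
    · simp
  calc staticCost ρ j ≤ 1 * ∫⁻ _u : Torus d, ENNReal.ofReal (d * M ^ 2 / κ) := by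
        unfold staticCost
        exact mul_le_mul' (by simp) (lintegral_mono fun u => ENNReal.ofReal_le_ofReal (h1 u))
    _ = _ := by simp

/-- The static cost of the connecting segments is bounded. -/
theorem exists_staticCost_rampProfile_le {γ ρ : Profile d} (hγ : IsC 1 γ) (hρ : IsC 1 ρ)
    (hγ1 : ∀ u, 0 < γ u ∧ γ u < 1) (hρ1 : ∀ u, 0 < ρ u ∧ ρ u < 1) (w : Fin d → C(Torus d, ℝ)) :
    ∃ C : ℝ, 0 ≤ C ∧ ∀ T t, staticCost (rampProfile γ ρ T t) (fun u i => w i u)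
      ≤ ENNReal.ofReal C := by
  obtain ⟨κ₁, h1, hκ₁⟩ := exists_pos_le_chi hγ.continuous hγ1
  obtain ⟨κ₂, h2, hκ₂⟩ := exists_pos_le_chi hρ.continuous hρ1
  have hp : ∀ {f : Torus d → ℝ}, IsC 1 f → ∀ i, Continuous (pderiv i f) := fun hf i =>
    (IsC.pderiv (n := 0) hf i).continuous
  let g : Fin d → C(Torus d, ℝ) := fun i => ⟨_, hp hγ i⟩
  let r : Fin d → C(Torus d, ℝ) := fun i => ⟨_, hp hρ i⟩
  -- The sum over all coordinates serves as one bound for every component of the drift, uniformly in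
  -- time and in `T`.
  set M : ℝ := ∑ i, (‖w i‖ + ‖g i‖ + ‖r i‖) with hM
  refine ⟨d * M ^ 2 / min κ₁ κ₂, by positivity, fun T t => staticCost_le_of_bound (lt_min h1 h2)
    (fun u i => ?_) fun u => chi_convex_comb (rampHeight_mem T t) ((min_le_left _ _).trans (hκ₁ u))
    ((min_le_right _ _).trans (hκ₂ u))⟩
  have hle : ‖w i‖ + ‖g i‖ + ‖r i‖ ≤ M :=
    Finset.single_le_sum (f := fun i => ‖w i‖ + ‖g i‖ + ‖r i‖) (fun i _ => by positivity)
      (Finset.mem_univ i)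
  refine le_trans ?_ hle
  have hd : pderiv i (rampProfile γ ρ T t) u
      = (1 - rampHeight T t) * g i u + rampHeight T t * r i u :=
    (pderiv_add (hγ.const_mul _) (hρ.const_mul _) i u).trans
      (by rw [pderiv_const_mul _ hγ, pderiv_const_mul _ hρ]; rfl)
  rw [drift, hd]
  obtain ⟨h3, h4⟩ := rampHeight_mem T t
  set a := rampHeight T t
  have b1 := abs_le.1 (((w i).norm_coe_le_norm u))
  have b2 := abs_le.1 (((g i).norm_coe_le_norm u))
  have b3 := abs_le.1 (((r i).norm_coe_le_norm u))
  have h5 : 0 ≤ 1 - a := by linarith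
  rw [abs_le]
  constructor <;> nlinarith [mul_nonneg h5 (sub_nonneg.2 b2.2), mul_nonneg h5 (sub_nonneg.2 b2.1),
    mul_nonneg h3 (sub_nonneg.2 b3.1), mul_nonneg h3 (sub_nonneg.2 b3.2), norm_nonneg (g i),
    norm_nonneg (r i), mul_nonneg h3 (norm_nonneg (g i)), mul_nonneg h5 (norm_nonneg (r i))]

/-- The current with a continuous density. -/
noncomputable def currentOfDensity (w : Fin d → C(Torus d, ℝ)) : Current d :=
  fun i => volume.withDensityᵥ fun u => w i u

theorem hasDensity_currentOfDensity (w : Fin d → C(Torus d, ℝ)) :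
    HasDensity (currentOfDensity w) fun u i => w i u :=
  fun i => ⟨integrable_of_continuous (w i).continuous, rfl⟩

theorem vpair_currentOfDensity_neg (w : Fin d → C(Torus d, ℝ)) {G : Torus d → Fin d → ℝ}
    (hG : ∀ i, Continuous fun u => G u i) :
    vpair (currentOfDensity (-w)) G = -vpair (currentOfDensity w) G := by
  rw [(hasDensity_currentOfDensity (-w)).vpair_eq hG, (hasDensity_currentOfDensity w).vpair_eq hG,
    ← integral_neg]
  simp

/-- The functional splits over `[0, 1]`, `[1, T - 1]` and `[T - 1, T]`. Adding the three bounds from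
`segment_le`, the boundary terms telescope and the one at `0` vanishes. In each use `X` is the value
of `W` at the left end of the segment. -/
theorem dynFunctional_ramp_le {γ ρ : Profile d} (hγ : IsC 1 γ) (hρ : IsC 1 ρ)
    (hγ1 : ∀ u, 0 < γ u ∧ γ u < 1) (hρ1 : ∀ u, 0 < ρ u ∧ ρ u < 1) (w : Fin d → C(Torus d, ℝ))
    {J : Current d} {j : Torus d → Fin d → ℝ} (hJ : HasDensity J j) {C S T : ℝ} (hT : 2 < T)
    (hC : 0 ≤ C) (hS : 0 ≤ S)
    (hC1 : ∀ t, staticCost (rampProfile γ ρ T t) (fun u i => w i u) ≤ ENNReal.ofReal C)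
    (hC2 : ∀ t, staticCost (rampProfile γ ρ T t) (fun u i => (-w) i u) ≤ ENNReal.ofReal C)
    (hSJ : staticCost ρ j ≤ ENNReal.ofReal S) {F : ℝ → Torus d → Fin d → ℝ} (hF : IsC11 F) :
    dynFunctional T (rampCurrent (currentOfDensity w) J T) (rampProfile γ ρ T) F
      ≤ 2 * C + (T - 2) * S := by
  set K := currentOfDensity w
  set W := rampCurrent K J T
  set π := rampProfile γ ρ T
  have hπ : Continuous fun z : ℝ × Torus d => π z.1 z.2 := by
    have h1 := hγ.continuous
    have h2 := hρ.continuous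
    have h3 := continuous_rampHeight T
    show Continuous fun z : ℝ × Torus d =>
      (1 - rampHeight T z.1) * γ z.2 + rampHeight T z.1 * ρ z.2
    fun_prop
  have hπ1 : ∀ t, IsC 1 (π t) ∧ ∀ u, 0 < π t u ∧ π t u < 1 := fun t =>
    ⟨isC_rampProfile hγ hρ T t, rampProfile_pos hγ1 hρ1 T t⟩
  have hFd : ∀ t i, Continuous fun u => timeDeriv F t u i := fun t i =>
    (hF.continuous_timeDeriv i).comp (continuous_const.prodMk continuous_id)
  have hFc : ∀ t i, Continuous fun u => F t u i := fun t i => (hF.isC t i).continuous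
  have s1 := segment_le hF (p := 0) (q := 1) zero_le_one hC (W := W) (π := π) (X := 0)
    (hasDensity_currentOfDensity w) (fun t ht G hG => by
      rw [vpair_rampCurrent K J T t hG, (ramp_first hT ht).1, (ramp_first hT ht).2]
      simp [vpair, K]) hπ (fun t _ => hπ1 t) fun t _ => hC1 t
  have s2 := segment_le hF (p := 1) (q := T - 1) (by linarith) hS (W := W) (π := π) (X := K)
    hJ (fun t ht G hG => by
      rw [vpair_rampCurrent K J T t hG, (ramp_middle ht).1, (ramp_middle ht).2]
      ring) hπ (fun t _ => hπ1 t) fun t ht => by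
        have : (π t : Torus d → ℝ) = ρ := by
          ext u
          rw [rampProfile_apply, (ramp_middle ht).1]
          ring
        rw [this]; exact hSJ
  have s3 := segment_le hF (p := T - 1) (q := T) (by linarith) hC (W := W) (π := π)
    (X := W (T - 1)) (hasDensity_currentOfDensity (-w)) (fun t ht G hG => by
      rw [vpair_rampCurrent K J T t hG, vpair_rampCurrent K J T (T - 1) hG,
        (ramp_last hT ht).1, (ramp_last hT ht).2, vpair_currentOfDensity_neg w hG,
        (ramp_last hT ⟨le_rfl, by linarith⟩).1, (ramp_last hT ⟨le_rfl, by linarith⟩).2]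
      ring) hπ (fun t _ => hπ1 t) fun t _ => hC2 t
  have cW : Continuous fun t => vpair (W t) (timeDeriv F t) := by
    simp only [W, fun t => vpair_rampCurrent K J T t (hFd t)]
    exact ((continuous_rampHeight T).mul (continuous_vpair_curve K hF.continuous_timeDeriv)).add
      ((continuous_rampTime T).mul (continuous_vpair_curve J hF.continuous_timeDeriv))
  have cdiv : Continuous fun t => dpair (π t) (Torus.div (F t)) :=
    continuous_integral_curve (hπ.mul hF.continuous_div)
  have cchi : Continuous fun t => dpair (fun u => chi (π t u)) (fun u => ∑ i, F t u i ^ 2) := by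
    refine continuous_integral_curve (f := fun t u => chi (π t u) * ∑ i, F t u i ^ 2) ?_
    have := hF.continuous
    unfold chi
    fun_prop
  have split : ∀ {f : ℝ → ℝ}, Continuous f → ∫ t in (0 : ℝ)..T, f t
      = (∫ t in (0 : ℝ)..1, f t) + (∫ t in (1 : ℝ)..(T - 1), f t) + ∫ t in (T - 1)..T, f t := by
    intro f hf
    rw [intervalIntegral.integral_add_adjacent_intervals (hf.intervalIntegrable _ _)
      (hf.intervalIntegrable _ _), intervalIntegral.integral_add_adjacent_intervals
      (hf.intervalIntegrable _ _) (hf.intervalIntegrable _ _)]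
  have h0 : vpair (W 0) (F 0) = 0 := by
    rw [vpair_rampCurrent K J T 0 (hFc 0), (ramp_first hT ⟨le_rfl, zero_le_one⟩).1,
      (ramp_first hT ⟨le_rfl, zero_le_one⟩).2]
    ring
  have e : dynFunctional T W π F = vpair (W T) (F T)
      - (∫ t in (0 : ℝ)..T, vpair (W t) (timeDeriv F t))
      - (1 / 2) * (∫ t in (0 : ℝ)..T, dpair (π t) (Torus.div (F t)))
      - (1 / 2) * ∫ t in (0 : ℝ)..T, dpair (fun u => chi (π t u)) (fun u => ∑ i, F t u i ^ 2) :=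
    rfl
  rw [e, split cW, split cdiv, split cchi]
  linarith

theorem smul_mem_divFree {J : Current d} (hJ : J ∈ divFree d) (c : ℝ) : c • J ∈ divFree d :=
  fun f hf => by rw [vpair_smul, hJ f hf, mul_zero]

/-- The divergence free `J` does not move the density. The current `invDiv` of `ρ - γ`, weighted by
`rampHeight`, produces exactly the interpolation. -/
theorem rampPath_mem {γ ρ : Profile d} (hγ : Continuous (γ : Torus d → ℝ))
    (hρ : Continuous (ρ : Torus d → ℝ)) (hmass : ∫ u, γ u = ∫ u, ρ u) {J : Current d}
    (hJ : J ∈ divFree d) {T : ℝ} (hT : 2 < T) :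
    (rampCurrent (currentOfDensity (invDiv ⟨fun u => ρ u - γ u, hρ.sub hγ⟩)) J T,
      rampProfile γ ρ T) ∈ continuityPaths T γ := by
  refine ⟨isCadlagOn_of_continuous (continuous_rampCurrent _ _ _) _,
    isCadlagOn_of_continuous (continuous_rampProfile _ _ _) _, ?_, fun t _ f hf => ?_⟩
  · simp [rampCurrent, (ramp_first hT ⟨le_rfl, zero_le_one⟩).1,
      (ramp_first hT ⟨le_rfl, zero_le_one⟩).2]
  · have hp : ∀ i, Continuous (pderiv i f) := fun i => (IsC.pderiv (n := 0) hf i).continuous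
    have h0 : ∫ u, (ρ u - γ u) = 0 := by
      rw [integral_sub ρ.integrable γ.integrable, hmass, sub_self]
    have h1 := integral_invDiv ⟨fun u => ρ u - γ u, hρ.sub hγ⟩ h0 hf
    set w := invDiv ⟨fun u => ρ u - γ u, hρ.sub hγ⟩
    have h2 : vpair (currentOfDensity w) (fun u i => pderiv i f u) = ∫ u, (ρ u - γ u) * f u := by
      rw [(hasDensity_currentOfDensity w).vpair_eq hp, integral_finsetSum]
      · exact h1
      · exact fun i _ => integrable_of_continuous ((w i).continuous.mul (hp i))
    rw [vpair_rampCurrent _ _ _ _ hp, h2, hJ f hf, dpair_rampProfile _ _ _ _ hf.continuous]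
    ring

/-- The currents of the two ramps cancel, so the total current is `(T - 2) J = T (1 - 2/T) J`. The
ramps have a cost independent of `T`, which becomes the `T⁻¹ C` term. -/
theorem exists_PhiTilde_le {γ ρ : Profile d} (hγ : IsC 1 γ) (hρ : IsC 1 ρ)
    (hγ1 : ∀ u, 0 < γ u ∧ γ u < 1) (hρ1 : ∀ u, 0 < ρ u ∧ ρ u < 1) (hmass : ∫ u, γ u = ∫ u, ρ u)
    {J : Current d} {j : Torus d → Fin d → ℝ} (hJ : J ∈ divFree d) (hJj : HasDensity J j) {S : ℝ}
    (hS : 0 ≤ S) (hSJ : staticCost ρ j ≤ ENNReal.ofReal S) :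
    ∃ C : ℝ, ∀ T, 2 < T →
      PhiTilde γ ((1 - 2 * T⁻¹) • J) ≤ ENNReal.ofReal (T⁻¹ * C + (1 - 2 * T⁻¹) * S) := by
  set w := invDiv ⟨fun u => ρ u - γ u, hρ.continuous.sub hγ.continuous⟩ with hw
  obtain ⟨C₁, hC₁, h1⟩ := exists_staticCost_rampProfile_le hγ hρ hγ1 hρ1 w
  obtain ⟨C₂, hC₂, h2⟩ := exists_staticCost_rampProfile_le hγ hρ hγ1 hρ1 (-w)
  refine ⟨2 * max C₁ C₂, fun T hT => ?_⟩
  have hT0 : 0 < T := by linarith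
  rw [PhiTilde, if_pos (smul_mem_divFree hJ _)]
  refine iInf₂_le_of_le T hT0 ?_
  have hrate : currentRate T γ (rampCurrent (currentOfDensity w) J T)
      ≤ ENNReal.ofReal (2 * max C₁ C₂ + (T - 2) * S) := by
    refine iInf_le_of_le (rampProfile γ ρ T) ?_
    rw [rate, if_pos (rampPath_mem hγ.continuous hρ.continuous hmass hJ hT), dynCost,
      if_pos ⟨(continuous_rampCurrent _ _ _).continuousOn, (continuous_rampProfile _ _ _).continuousOn⟩]
    refine iSup₂_le fun F hF => ENNReal.ofReal_le_ofReal ?_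
    exact dynFunctional_ramp_le hγ hρ hγ1 hρ1 w hJj hT (le_max_of_le_left hC₁) hS
      (fun t => (h1 T t).trans (ENNReal.ofReal_le_ofReal (le_max_left _ _)))
      (fun t => (h2 T t).trans (ENNReal.ofReal_le_ofReal (le_max_right _ _))) hSJ hF
  have hmem : rampCurrent (currentOfDensity w) J T ∈ meanPaths T ((1 - 2 * T⁻¹) • J) := by
    refine ⟨isCadlagOn_of_continuous (continuous_rampCurrent _ _ _) _, ?_⟩
    have hl := ramp_last hT (t := T) ⟨by linarith, le_rfl⟩
    rw [rampCurrent, hl.1, hl.2, sub_self, zero_smul, zero_add, smul_smul]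
    congr 1
    field_simp
  calc PhiT T γ ((1 - 2 * T⁻¹) • J)
      ≤ (ENNReal.ofReal T)⁻¹ * ENNReal.ofReal (2 * max C₁ C₂ + (T - 2) * S) := by
        unfold PhiT
        gcongr
        exact iInf₂_le_of_le _ hmem hrate
    _ = _ := by
        rw [← ENNReal.ofReal_inv_of_pos hT0, ← ENNReal.ofReal_mul (inv_nonneg.2 hT0.le)]
        congr 1
        field_simp

/-- The currents `(1 - 2/T) J` eventually enter each neighbourhood of `J`, and their costs are
bounded by a quantity tending to the static cost. -/
theorem Phi_le_staticCost {γ ρ : Profile d} (hγ : IsC 1 γ) (hρ : IsC 1 ρ)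
    (hγ1 : ∀ u, 0 < γ u ∧ γ u < 1) (hρ1 : ∀ u, 0 < ρ u ∧ ρ u < 1) (hmass : ∫ u, γ u = ∫ u, ρ u)
    {J : Current d} {j : Torus d → Fin d → ℝ} (hJ : J ∈ divFree d) (hJj : HasDensity J j) :
    Phi γ J ≤ staticCost ρ j := by
  by_cases htop : staticCost ρ j = ⊤
  · rw [htop]; exact le_top
  rw [← ENNReal.ofReal_toReal htop]
  set S := (staticCost ρ j).toReal
  obtain ⟨C, hC⟩ := exists_PhiTilde_le hγ hρ hγ1 hρ1 hmass hJ hJj (S := S) ENNReal.toReal_nonneg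
    (ENNReal.ofReal_toReal htop).ge
  refine iSup₂_le fun V hV => ?_
  have hinv : Tendsto (fun T : ℝ => T⁻¹) atTop (𝓝 0) := tendsto_inv_atTop_zero
  have hlim : Tendsto (fun T : ℝ => ENNReal.ofReal (T⁻¹ * C + (1 - 2 * T⁻¹) * S)) atTop
      (𝓝 (ENNReal.ofReal S)) := by
    have h : Continuous fun x : ℝ => ENNReal.ofReal (x * C + (1 - 2 * x) * S) :=
      ENNReal.continuous_ofReal.comp (by fun_prop)
    have := (h.tendsto 0).comp hinv
    simpa [Function.comp_def] using this
  have hJlim : Tendsto (fun T : ℝ => (1 - 2 * T⁻¹) • J) atTop (𝓝 J) := by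
    have h : Continuous fun x : ℝ => (1 - 2 * x) • J := by
      rw [continuous_current_iff]
      intro i F
      simp only [Pi.smul_apply, pair_smul_measure]
      fun_prop
    have := (h.tendsto 0).comp hinv
    simpa [Function.comp_def] using this
  refine ge_of_tendsto hlim ?_
  filter_upwards [eventually_gt_atTop 2, hJlim.eventually (hV.1.mem_nhds hV.2)] with T hT hTV
  exact iInf₂_le_of_le _ hTV (hC T hT)

end MeanCurrent

theorem proposition5p1 (d : ℕ) (m : ℝ) (hm : 0 < m ∧ m < 1) :
    LowerSemicontinuous (MeanCurrent.U m : MeanCurrent.Current d → ℝ≥0∞) ∧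
    ∀ γ : MeanCurrent.Profile d, γ ∈ MeanCurrent.massProfiles d m → Torus.IsC 2 γ →
      (∃ δ : ℝ, 0 < δ ∧ ∀ u, δ ≤ γ u ∧ γ u ≤ 1 - δ) →
      ∀ J : MeanCurrent.Current d, MeanCurrent.U m J = MeanCurrent.Phi γ J := by
  refine ⟨MeanCurrent.lowerSemicontinuous_U hm, fun γ hγm hγ hδ J =>
    le_antisymm (MeanCurrent.U_le_Phi hm hγm J) ?_⟩
  obtain ⟨δ, hδ0, hδ⟩ := hδ
  refine le_iInf₂ fun j hJ => le_iInf₂ fun ρ hρ => ?_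
  exact MeanCurrent.Phi_le_staticCost (hγ.of_le (by norm_num)) (hρ.2.1.of_le (by norm_num))
    (fun u => ⟨hδ0.trans_le (hδ u).1, by linarith [(hδ u).2]⟩) hρ.2.2
    (Eq.trans hγm (Eq.symm hρ.1)) hJ.1 hJ.2
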